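/- **Setting.** There are $M\ge 1$ agents and $K>M$ arms. Let $\mathcal G$ be the set of the $K^M$ maps $G$ from agents to arms (called matchings; several agents may share an arm). For a matrix $r\in[0,1]^{M\times K}$ put $U(G;r)=\sum_m r_{m,G(m)}\,\mathbf 1\{G(m')\ne G(m)\ \forall m'\ne m\}$. Let $\mu\in[0,1]^{M\times K}$ be such that $U(\cdot\,;\mu)$ has a unique maximizer $G^*$ over $\mathcal G$, and let $\Delta^{\mathrm{match}}_{\min}=\min_{G\ne G^*}\big(U(G^*;\mu)-U(G;\mu)\big)$. At each round $t=1,2,\dots$ a random matrix $X(t)\in\{0,1\}^{M\times K}$ with $\mathbb P(X_{m,k}(t)=1)=\mu_{m,k}$ is drawn, independently over rounds. Let $\mathrm{kl}(p,q)\in[0,\infty]$ be the Kullback–Leibler divergence between Bernoulli laws with means $p,q\in[0,1]$, and let $f(t)=\log t+4\log\log t$. **Algorithm HCLA.** For each $G\in\mathcal G$, at the start of round $t$, let $N_G(t)$ be the number of earlier rounds in which $G$ was observed (pulled or hinted), and let $\hat\mu_G(t)$ be the average of $U(G;X(s))$ over these rounds $s$ ($0$ if there are none). Let $d_G(1)=0$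 and, for $t\ge2$, $$d_G(t)=\sup\{q\in[0,M]: N_G(t)\,\mathrm{kl}(\hat\mu_G(t)/M,\,q/M)\le f(t)\},$$ with $0\cdot\infty=0$ and $\sup\emptyset=0$. In round $t$: choose $G(t)\in\arg\max_{G\in\mathcal G}\hat\mu_G(t)$ and another matching $G'(t)\in\arg\max_{G\in\mathcal G,\ G\ne G(t)}d_G(t)$ (ties broken by an arbitrary rule depending on the round and the statistics). If $d_{G'(t)}(t)>\hat\mu_{G(t)}(t)$, every agent queries one hint: the hinted matching $G^{\mathrm{hint}}(t)$ is $G'(t)$ with probability $1/2$ and otherwise a uniformly random element of $\mathcal G$ (the coin and the random matching are fresh, independent of each other, of $X(t)$ and of all other rounds), and $U(G^{\mathrm{hint}}(t);X(t))$ is observed. Finally $G(t)$ is pulled and $U(G(t);X(t))$ is observed. Let $R(T)=\sum_{t=1}^T\big(U(G^*;\mu)-\mathbb E[U(G(t);\mu)]\big)$, let $L(T)$ be the expected total number of hints queried by all agents up to round $T$, and for $0<\delta<\Delta^{\mathrm{match}}_{\min}/2$ let $$\Delta^{\mathrm{kl}}=\mathrm{kl}\Big(\tfrac{U(G^*;\mu)-\Delta^{\mathrm{match}}_{\min}+\delta}{M},\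 \tfrac{U(G^*;\mu)-\delta}{M}\Big).$$ **Theorem.** 1. (Time-independent regret $O(MK^{2M})$.) For every $\delta>0$ there is a constant $C>0$ depending only on $\delta$ such that for all $M,K,\mu$ as above with $\delta<\Delta^{\mathrm{match}}_{\min}/2$ and for all $T$: $R(T)\le C\,M K^{2M}$. 2. (Hint complexity.) There is an absolute constant $C>0$ such that for all $M,K,\mu$ as above and all $0<\delta<\Delta^{\mathrm{match}}_{\min}/2$, for all sufficiently large $T$: $L(T)\le C\,\dfrac{M K^M\log T}{\Delta^{\mathrm{kl}}}$. -/

import Mathlib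

open MeasureTheory ProbabilityTheory

namespace HintedBandit

/-- An assignment of one arm to each agent (collisions allowed): the super arms. -/
abbrev Matching (M K : ℕ) := Fin M → Fin K

open Classical in
/-- Utility of a matching for a reward (or mean reward) matrix: an agent whose arm is shared with
another agent contributes zero. -/
noncomputable def utility {M K : ℕ} (G : Matching M K) (r : Fin M → Fin K → ℝ) : ℝ :=
  ∑ m, if ∀ m', m' ≠ m → G m' ≠ G m then r m (G m) else 0

/-- A bandit instance: a matrix of Bernoulli means with a unique optimal matching `best`. -/
structure Instance (M K : ℕ) where
  mean : Fin M → Fin K → ℝ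
  mean_mem : ∀ m k, mean m k ∈ Set.Icc (0 : ℝ) 1
  best : Matching M K
  best_unique : ∀ G, G ≠ best → utility G mean < utility best mean

/-- The minimum gap between the optimal matching and any other one. -/
noncomputable def Instance.minGap {M K : ℕ} (I : Instance M K) : ℝ :=
  ⨅ G : {G : Matching M K // G ≠ I.best}, (utility I.best I.mean - utility G.1 I.mean)

open Classical in
/-- Kullback-Leibler divergence between the Bernoulli laws with means `p, q ∈ [0, 1]`; the value is
`⊤` when the first law is not absolutely continuous with respect to the second. -/
noncomputable def klBer (p q : ℝ) : EReal :=
  if (q = 0 ∧ p ≠ 0) ∨ (q = 1 ∧ p ≠ 1) then ⊤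
  else ((p * Real.log (p / q) + (1 - p) * Real.log ((1 - p) / (1 - q)) : ℝ) : EReal)

/-- The divergence gap at tolerance `δ`. Utilities lie in `[0, M]` and are rescaled by `1 / M`. -/
noncomputable def Instance.klGap {M K : ℕ} (I : Instance M K) (δ : ℝ) : ℝ :=
  (klBer ((utility I.best I.mean - I.minGap + δ) / M) ((utility I.best I.mean - δ) / M)).toReal

/-- The randomness of a run: at round `t`, the realizations `X t m k` of all rewards, the fair coin
`coin t` and the uniformly random matching `unif t` of the algorithm. Rounds are independent. No
independence between different edges in the same round is required. -/
structure Environment {M K : ℕ} (I : Instance M K) {Ω : Type*} [MeasurableSpace Ω]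
    (P : Measure Ω) where
  X : ℕ → Ω → Fin M → Fin K → Bool
  coin : ℕ → Ω → Bool
  unif : ℕ → Ω → Matching M K
  measurable_X : ∀ t, Measurable (X t)
  measurable_coin : ∀ t, Measurable (coin t)
  measurable_unif : ∀ t, Measurable (unif t)
  law_X : ∀ t m k, P.real {ω | X t ω m k = true} = I.mean m k
  law_coin : ∀ t, P.real {ω | coin t ω = true} = 1 / 2
  law_unif : ∀ t G, P.real {ω | unif t ω = G} = 1 / (K : ℝ) ^ M
  indep_rounds : iIndepFun (fun t ω => (X t ω, coin t ω, unif t ω)) P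
  indep_X : ∀ t, IndepFun (X t) (fun ω => (coin t ω, unif t ω)) P
  indep_coin : ∀ t, IndepFun (coin t) (unif t) P

/-- A 0/1 reward matrix as a real matrix. -/
def toReward {M K : ℕ} (x : Fin M → Fin K → Bool) : Fin M → Fin K → ℝ :=
  fun m k => if x m k then 1 else 0

/-- Matching-level statistics: in how many rounds each matching was observed (pulled or hinted), and
the total utility observed for it. -/
structure Stats (M K : ℕ) where
  count : Matching M K → ℕ
  total : Matching M K → ℝ

/-- Empirical mean (`0` for a matching never observed). -/
noncomputable def Stats.empMean {M K : ℕ} (s : Stats M K) (G : Matching M K) : ℝ :=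
  s.total G / s.count G

/-- Exploration function. -/
noncomputable def explore (t : ℕ) : ℝ := Real.log t + 4 * Real.log (Real.log t)

/-- The kl-UCB index of `G` at round `t`, initialised to `0` at round `1`. It is `0` if no `q`
qualifies, and `M`, the largest possible utility, if `G` was never observed and `t ≥ 3`. -/
noncomputable def Stats.index {M K : ℕ} (s : Stats M K) (t : ℕ) (G : Matching M K) : ℝ :=
  if t ≤ 1 then 0
  else sSup {q : ℝ | 0 ≤ q ∧ q ≤ M ∧
    ((s.count G : ℝ) : EReal) * klBer (s.empMean G / M) (q / M) ≤ ((explore t : ℝ) : EReal)}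

open Classical in
/-- The maximizers of `f` over `S`. -/
noncomputable def argmaxOn {α : Type*} (S : Finset α) (f : α → ℝ) : Finset α :=
  S.filter fun a => ∀ b ∈ S, f b ≤ f a

/-- Arbitrary rules for breaking ties in the two argmax steps; they may depend on the round and on
the statistics. -/
structure TieBreak (M K : ℕ) where
  pull : ℕ → Stats M K → Finset (Matching M K) → Matching M K
  cand : ℕ → Stats M K → Finset (Matching M K) → Matching M K
  pull_mem : ∀ t s S, S.Nonempty → pull t s S ∈ S
  cand_mem : ∀ t s S, S.Nonempty → cand t s S ∈ S

namespace TieBreak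

variable {M K : ℕ} (τ : TieBreak M K)

/-- The matching pulled at round `t`: maximal empirical mean. -/
noncomputable def pulled (t : ℕ) (s : Stats M K) : Matching M K :=
  τ.pull t s (argmaxOn Finset.univ s.empMean)

/-- The hint candidate at round `t`: another matching, with maximal kl-UCB index. -/
noncomputable def candidate (t : ℕ) (s : Stats M K) : Matching M K :=
  τ.cand t s (argmaxOn (Finset.univ.erase (τ.pulled t s)) (s.index t))

/-- The condition under which all agents query a hint at round `t`. -/
def Asks (t : ℕ) (s : Stats M K) : Prop :=
  s.index t (τ.candidate t s) > s.empMean (τ.pulled t s)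

/-- The matching `G` is observed at round `t`, where `b` is the coin and `V` the random matching:
it is pulled, or it is the hinted one. -/
def Observed (t : ℕ) (s : Stats M K) (b : Bool) (V G : Matching M K) : Prop :=
  G = τ.pulled t s ∨ (τ.Asks t s ∧ G = if b then τ.candidate t s else V)

open Classical in
/-- One round of HCLA. -/
noncomputable def step (t : ℕ) (s : Stats M K) (x : Fin M → Fin K → Bool) (b : Bool)
    (V : Matching M K) : Stats M K where
  count G := s.count G + if τ.Observed t s b V G then 1 else 0
  total G := s.total G + if τ.Observed t s b V G then utility G (toReward x) else 0

end TieBreak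

namespace Environment

variable {M K : ℕ} {I : Instance M K} {Ω : Type*} [MeasurableSpace Ω] {P : Measure Ω}
  (E : Environment I P) (τ : TieBreak M K)

/-- The statistics of HCLA after `n` rounds. Rounds are numbered from `1`. -/
noncomputable def stats : ℕ → Ω → Stats M K
  | 0, _ => ⟨fun _ => 0, fun _ => 0⟩
  | n + 1, ω => τ.step (n + 1) (stats n ω) (E.X (n + 1) ω) (E.coin (n + 1) ω) (E.unif (n + 1) ω)

/-- Regret of HCLA after `T` rounds. -/
noncomputable def regret (T : ℕ) : ℝ :=
  ∑ t ∈ Finset.Icc 1 T,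
    (utility I.best I.mean - ∫ ω, utility (τ.pulled t (E.stats τ (t - 1) ω)) I.mean ∂P)

open Classical in
/-- Expected number of hints queried by all agents during the first `T` rounds of HCLA: whenever a
hint is queried, each of the `M` agents queries one. -/
noncomputable def hints (T : ℕ) : ℝ :=
  ∫ ω, (∑ _m : Fin M, ∑ t ∈ Finset.Icc 1 T,
    if τ.Asks t (E.stats τ (t - 1) ω) then (1 : ℝ) else 0) ∂P

end Environment

end HintedBandit

/-! ### Bernoulli divergence and its exponential tilts -/

namespace HintedBandit

/-! Bad rounds are charged to observations. A matching has its `(k + 1)`-th observation at most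
once, and at that moment its empirical mean is off by `δ` with probability at most `exp (-2 δ² k /
M²)`. Summing the geometric series, the expected number of rounds in which a given matching is
observed while its estimate is off by `δ` on a given side is at most `1 + M² / (2 δ²)`, whatever the
horizon (`sum_measureReal_obs_deviation_le`). Adaptive sampling is harmless because `exp (l * total
- ψ * count)` is a supermartingale (`sum_integral_tilt_le_one`).

Regret (`sum_measureReal_pulled_ne_best_le`). If a suboptimal matching is pulled, either its own
mean is too high, which is charged to its observation, or the mean of the best matching is too low
by `δ`. In the latter case, if the index of the best matching reaches its true utility, then a hint
is queried and the best matching is observed with conditional probability at least `1 / (2 K ^ M)`,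
so the round is charged at that price. Otherwise the kl-UCB index fails; a union bound over the
number of observations gives this probability `O(1 / (t log³ t))`, which is summable
(`sum_measureReal_index_lt_le`). The bad rounds number `O(K ^ M * M² / δ²)`, and `M² ≤ K ^ M`.

Hints (`sum_measureReal_asks_le`). Outside bounded-in-expectation exceptions, the best matching is
pulled and both relevant means are accurate. A hint then forces the candidate's count to be at most
`5 log T / klGap` (`count_mul_klGap_le`). Each hint observes the candidate with probability at least
`1/2`, so every matching accounts for at most about `10 log T / klGap` hints. -/

lemma one_sub_add_mul_exp_pos {p : ℝ} (hp : p ∈ Set.Icc (0 : ℝ) 1) (l : ℝ) :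
    0 < 1 - p + p * Real.exp l := by
  rcases eq_or_lt_of_le hp.1 with h | h
  · simp [← h]
  · have := mul_pos h (Real.exp_pos l)
    linarith [hp.2]

lemma sub_le_mul_log_div {x w : ℝ} (hx : 0 ≤ x) (hw : 0 ≤ w) (h : w = 0 → x = 0) :
    x - w ≤ x * Real.log (x / w) := by
  rcases eq_or_lt_of_le hx with hx0 | hx0
  · simp [← hx0, hw]
  have hw0 : 0 < w := lt_of_le_of_ne hw fun h' => hx0.ne' (h h'.symm)
  have h1 := Real.one_sub_inv_le_log_of_pos (div_pos hx0 hw0)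
  calc x - w = x * (1 - (x / w)⁻¹) := by field_simp
    _ ≤ _ := mul_le_mul_of_nonneg_left h1 hx

/-- Donsker–Varadhan lower bound for the Bernoulli divergence. -/
lemma le_klBer {x y : ℝ} (hx : x ∈ Set.Icc (0 : ℝ) 1) (hy : y ∈ Set.Icc (0 : ℝ) 1) (l : ℝ) :
    ((l * x - Real.log (1 - y + y * Real.exp l) : ℝ) : EReal) ≤ klBer x y := by
  unfold klBer
  split_ifs with h
  · exact le_top
  push Not at h
  have hZ := one_sub_add_mul_exp_pos hy l
  set Z := 1 - y + y * Real.exp l with hZdef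
  rw [EReal.coe_le_coe_iff]
  -- `h1` and `h2` bound below the two terms of the divergence from `x` to the tilted law with
  -- weights `y e^l / Z` and `(1 - y) / Z`; these weights sum to one, so the sum is nonnegative.
  have h1 : x - y * Real.exp l / Z ≤ x * (Real.log (x / y) - l + Real.log Z) := by
    rcases eq_or_lt_of_le hx.1 with hx0 | hx0
    · have : 0 ≤ y * Real.exp l / Z := div_nonneg (mul_nonneg hy.1 (Real.exp_pos l).le) hZ.le
      simp [← hx0, this]
    have hy0 : 0 < y := lt_of_le_of_ne hy.1 fun h' => hx0.ne' (h.1 h'.symm)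
    have hw : 0 < y * Real.exp l / Z := div_pos (mul_pos hy0 (Real.exp_pos l)) hZ
    refine (sub_le_mul_log_div hx.1 hw.le fun h' => absurd h' hw.ne').trans_eq ?_
    congr 1
    rw [Real.log_div hx0.ne' hw.ne', Real.log_div (mul_pos hy0 (Real.exp_pos l)).ne' hZ.ne',
      Real.log_mul hy0.ne' (Real.exp_pos l).ne', Real.log_exp, Real.log_div hx0.ne' hy0.ne']
    ring
  have h2 : (1 - x) - (1 - y) / Z ≤ (1 - x) * (Real.log ((1 - x) / (1 - y)) + Real.log Z) := by
    rcases eq_or_lt_of_le hx.2 with hx0 | hx0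
    · have : 0 ≤ (1 - y) / Z := div_nonneg (by linarith [hy.2]) hZ.le
      simp [hx0, this]
    have hy0 : 0 < 1 - y := by
      have : y ≠ 1 := fun h' => hx0.ne (h.2 h')
      linarith [lt_of_le_of_ne hy.2 this]
    have hx0' : 0 < 1 - x := by linarith
    have hw : 0 < (1 - y) / Z := div_pos hy0 hZ
    refine (sub_le_mul_log_div hx0'.le hw.le fun h' => absurd h' hw.ne').trans_eq ?_
    congr 1
    rw [Real.log_div hx0'.ne' hw.ne', Real.log_div hy0.ne' hZ.ne', Real.log_div hx0'.ne' hy0.ne']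
    ring
  have h3 : y * Real.exp l / Z + (1 - y) / Z = 1 := by
    rw [← add_div, hZdef, add_comm, div_self hZ.ne']
  linarith

/-- The optimal tilt moves the mean from `y` to `x`, so `l` is the log odds ratio, nonpositive when
`x ≤ y`. Equality in `le_klBer` fails to be attained at the endpoints, hence the open intervals. -/
lemma exists_klBer_eq {x y : ℝ} (hx : x ∈ Set.Ioo (0 : ℝ) 1) (hy : y ∈ Set.Ioo (0 : ℝ) 1)
    (hxy : x ≤ y) : ∃ l ≤ 0,
      klBer x y = ((l * x - Real.log (1 - y + y * Real.exp l) : ℝ) : EReal) := by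
  have hx1 : 0 < 1 - x := by linarith [hx.2]
  have hy1 : 0 < 1 - y := by linarith [hy.2]
  have hpos : 0 < x * (1 - y) / (y * (1 - x)) :=
    div_pos (mul_pos hx.1 hy1) (mul_pos hy.1 hx1)
  refine ⟨Real.log (x * (1 - y) / (y * (1 - x))), Real.log_nonpos hpos.le ?_, ?_⟩
  · rw [div_le_one (mul_pos hy.1 hx1)]
    nlinarith
  have hne : ¬((y = 0 ∧ x ≠ 0) ∨ (y = 1 ∧ x ≠ 1)) := by
    rintro (h | h)
    · exact hy.1.ne' h.1
    · exact hy.2.ne h.1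
  rw [klBer, if_neg hne, Real.exp_log hpos]
  congr 1
  have hZ : 1 - y + y * (x * (1 - y) / (y * (1 - x))) = (1 - y) / (1 - x) := by
    have := hy.1.ne'
    field_simp
    ring
  rw [hZ, Real.log_div (mul_pos hx.1 hy1).ne' (mul_pos hy.1 hx1).ne',
    Real.log_mul hx.1.ne' hy1.ne', Real.log_mul hy.1.ne' hx1.ne', Real.log_div hy1.ne' hx1.ne',
    Real.log_div hx.1.ne' hy.1.ne', Real.log_div hx1.ne' hy1.ne']
  ring

/-- Test `(x, y)` with the tilt optimal for `(a, b)`: as `l ≤ 0`, the variational expression only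
grows when `x` decreases and `y` increases. -/
lemma klBer_mono {x a b y : ℝ} (hx : 0 ≤ x) (hxa : x ≤ a) (ha : 0 < a) (hab : a ≤ b) (hb : b < 1)
    (hby : b ≤ y) (hy : y ≤ 1) : klBer a b ≤ klBer x y := by
  obtain ⟨l, hl, h⟩ := exists_klBer_eq ⟨ha, by linarith⟩ ⟨by linarith, hb⟩ hab
  rw [h]
  refine le_trans ?_ (le_klBer ⟨hx, by linarith⟩ ⟨by linarith, hy⟩ l)
  rw [EReal.coe_le_coe_iff]
  have h1 : l * a ≤ l * x := mul_le_mul_of_nonpos_left hxa hl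
  have h2 : Real.log (1 - y + y * Real.exp l) ≤ Real.log (1 - b + b * Real.exp l) := by
    apply Real.log_le_log (one_sub_add_mul_exp_pos ⟨by linarith, hy⟩ l)
    have : Real.exp l ≤ 1 := Real.exp_le_one_iff.2 hl
    nlinarith
  linarith

lemma klBer_toReal_pos {a b : ℝ} (ha : 0 < a) (hab : a < b) (hb : b < 1) :
    0 < (klBer a b).toReal := by
  obtain ⟨l, hl, h⟩ := exists_klBer_eq ⟨ha, by linarith⟩ ⟨by linarith, hb⟩ hab.le
  have hb' : b ∈ Set.Icc (0 : ℝ) 1 := ⟨by linarith, hb.le⟩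
  -- With `l = -(b - a)` and `e^l ≤ 1 + l + l²`, the variational bound is at least `(b - a)² (1 - b)
  -- > 0`.
  have h1 := le_klBer (x := a) ⟨ha.le, by linarith⟩ hb' (-(b - a))
  rw [h, EReal.coe_le_coe_iff] at h1
  rw [h, EReal.toReal_coe]
  refine lt_of_lt_of_le ?_ h1
  have h2 := Real.log_le_sub_one_of_pos (one_sub_add_mul_exp_pos hb' (-(b - a)))
  have h3 : Real.exp (-(b - a)) ≤ 1 + -(b - a) + (-(b - a)) ^ 2 := by
    have := Real.abs_exp_sub_one_sub_id_le (x := -(b - a)) (by rw [abs_le]; constructor <;> linarith)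
    linarith [(abs_le.1 this).2]
  have h4 : b * Real.exp (-(b - a)) ≤ b * (1 + -(b - a) + (-(b - a)) ^ 2) :=
    mul_le_mul_of_nonneg_left h3 hb'.1
  have h5 : 0 < (b - a) ^ 2 * (1 - b) := mul_pos (pow_pos (by linarith) 2) (by linarith)
  nlinarith

lemma klBer_eq_coe {a b : ℝ} (h0 : b ≠ 0) (h1 : b ≠ 1) :
    klBer a b = ((klBer a b).toReal : EReal) := by
  have hne : ¬((b = 0 ∧ a ≠ 0) ∨ (b = 1 ∧ a ≠ 1)) := by
    rintro (h | h)
    · exact h0 h.1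
    · exact h1 h.1
  rw [klBer, if_neg hne, EReal.toReal_coe]

lemma continuous_klBer_formula {p : ℝ} (h0 : p ≠ 0) (h1 : p ≠ 1) :
    Continuous fun x : ℝ => x * Real.log (x / p) + (1 - x) * Real.log ((1 - x) / (1 - p)) := by
  have h1' : 1 - p ≠ 0 := sub_ne_zero.2 h1.symm
  have : (fun x : ℝ => x * Real.log (x / p) + (1 - x) * Real.log ((1 - x) / (1 - p))) =
      fun x => p * ((x / p) * Real.log (x / p)) +
        (1 - p) * (((1 - x) / (1 - p)) * Real.log ((1 - x) / (1 - p))) := by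
    ext x
    field_simp
  rw [this]
  have h2 : Continuous fun x : ℝ => (x / p) * Real.log (x / p) :=
    Real.continuous_mul_log.comp (continuous_id.div_const p)
  have h3 : Continuous fun x : ℝ => ((1 - x) / (1 - p)) * Real.log ((1 - x) / (1 - p)) :=
    Real.continuous_mul_log.comp ((continuous_const.sub continuous_id).div_const (1 - p))
  exact (continuous_const.mul h2).add (continuous_const.mul h3)

/-- A single exponential tilt detects a large divergence on the whole left tail. -/
lemma exists_tilt {p c η ε : ℝ} (hp0 : 0 < p) (hp1 : p ≤ 1) (hc : 0 ≤ c) (hη : 0 < η)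
    (hε : 0 < ε) : ∃ l : ℝ, ∀ x, 0 ≤ x → x ≤ p - η → (c : EReal) < klBer x p →
      c - ε ≤ l * x - Real.log (1 - p + p * Real.exp l) := by
  -- For `p = 1` the tilted expression is `l (x - 1)`, and the margin `1 - x ≥ η` makes `l = -c / η`
  -- sufficient.
  rcases eq_or_lt_of_le hp1 with h1 | h1
  · refine ⟨-(c / η), fun x hx hxp _ => ?_⟩
    subst h1
    simp only [sub_self, one_mul, zero_add, Real.log_exp]
    have : c / η * η ≤ c / η * (1 - x) :=
      mul_le_mul_of_nonneg_left (by linarith) (div_nonneg hc hη.le)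
    rw [div_mul_cancel₀ _ hη.ne'] at this
    linarith
  set g : ℝ → ℝ := fun x => x * Real.log (x / p) + (1 - x) * Real.log ((1 - x) / (1 - p)) with hg
  have hgc : Continuous g := continuous_klBer_formula hp0.ne' h1.ne
  have hkl : ∀ x, klBer x p = ((g x : ℝ) : EReal) := by
    intro x
    have hne : ¬((p = 0 ∧ x ≠ 0) ∨ (p = 1 ∧ x ≠ 1)) := by
      rintro (h | h)
      · exact hp0.ne' h.1
      · exact h1.ne h.1
    rw [klBer, if_neg hne]
  set A : Set ℝ := Set.Icc 0 (p - η) ∩ {x | c ≤ g x} with hA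
  have hAc : IsCompact A := isCompact_Icc.inter_right (isClosed_le continuous_const hgc)
  rcases A.eq_empty_or_nonempty with hAe | hAne
  · refine ⟨0, fun x hx hxp hlt => ?_⟩
    rw [hkl, EReal.coe_lt_coe_iff] at hlt
    have : x ∈ A := ⟨⟨hx, hxp⟩, hlt.le⟩
    simp [hAe] at this
  obtain ⟨x0, hx0A, hx0⟩ := hAc.exists_isGreatest hAne
  have hev : ∀ᶠ z in nhds x0, c - ε < g z :=
    hgc.continuousAt.eventually (lt_mem_nhds (by linarith [hx0A.2.out]))
  obtain ⟨r, hr, hball⟩ := Metric.eventually_nhds_iff.1 hev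
  have hx0p : x0 < p := by linarith [hx0A.1.2]
  -- The offending points all lie to the left of `x0`, so the tilt for a point near `x0` serves them
  -- all. Since `x0` may be `0`, where no finite tilt is optimal, a slightly larger `x1` is used at
  -- the cost of `ε`.
  set x1 := x0 + min (r / 2) ((p - x0) / 2) with hx1
  have hm : 0 < min (r / 2) ((p - x0) / 2) := lt_min (by linarith) (by linarith)
  have hx1p : x1 ≤ p := by linarith [min_le_right (r / 2) ((p - x0) / 2)]
  have hx10 : 0 < x1 := by linarith [hx0A.1.1]
  have hgx1 : c - ε < g x1 := by
    apply hball
    rw [Real.dist_eq, hx1, add_sub_cancel_left, abs_of_pos hm]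
    linarith [min_le_left (r / 2) ((p - x0) / 2)]
  obtain ⟨l, hl, h⟩ := exists_klBer_eq ⟨hx10, by linarith⟩ ⟨hp0, h1⟩ hx1p
  rw [hkl, EReal.coe_eq_coe_iff] at h
  refine ⟨l, fun x hx hxp hlt => ?_⟩
  rw [hkl, EReal.coe_lt_coe_iff] at hlt
  have hxx0 : x ≤ x0 := hx0 ⟨⟨hx, hxp⟩, hlt.le⟩
  have : l * x1 ≤ l * x := mul_le_mul_of_nonpos_left (by linarith) hl
  linarith

end HintedBandit

/-! ### Independence of past, hint randomness and rewards -/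

namespace HintedBandit

/-- Used with the past as `H`, the current rewards as `Y` and the coin with the random matching as
`C`: what is observed depends on `(H, C)` and must be independent of `Y`. -/
lemma indepFun_prodMk_of_indepFun {Ω α β γ : Type*} [MeasurableSpace Ω] [MeasurableSpace α]
    [MeasurableSpace β] [MeasurableSpace γ] {P : Measure Ω} [IsProbabilityMeasure P]
    {H : Ω → α} {Y : Ω → β} {C : Ω → γ} (hH : Measurable H) (hY : Measurable Y)
    (hC : Measurable C) (h1 : IndepFun H (fun ω => (Y ω, C ω)) P) (h2 : IndepFun Y C P) :
    IndepFun (fun ω => (H ω, C ω)) Y P := by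
  have := Measure.isProbabilityMeasure_map (μ := P) hH.aemeasurable
  have := Measure.isProbabilityMeasure_map (μ := P) hC.aemeasurable
  have := Measure.isProbabilityMeasure_map (μ := P) hY.aemeasurable
  have hHC : IndepFun H C P := h1.comp measurable_id measurable_snd
  have h1' : IndepFun H (fun ω => (C ω, Y ω)) P := h1.comp measurable_id measurable_swap
  rw [indepFun_iff_map_prod_eq_prod_map_map (hH.prodMk hC).aemeasurable hY.aemeasurable]
  rw [indepFun_iff_map_prod_eq_prod_map_map hH.aemeasurable hC.aemeasurable] at hHC
  rw [indepFun_iff_map_prod_eq_prod_map_map hH.aemeasurable (hC.prodMk hY).aemeasurable,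
    (indepFun_iff_map_prod_eq_prod_map_map hC.aemeasurable hY.aemeasurable).1 h2.symm,
    ← Measure.prodAssoc_prod] at h1'
  apply MeasurableEquiv.map_measurableEquiv_injective MeasurableEquiv.prodAssoc
  rw [hHC, ← h1', Measure.map_map MeasurableEquiv.prodAssoc.measurable
    ((hH.prodMk hC).prodMk hY)]
  rfl

/-- The randomness of one round: rewards, coin and random matching. -/
abbrev Round (M K : ℕ) := (Fin M → Fin K → Bool) × Bool × Matching M K

namespace Environment

variable {M K : ℕ} {I : Instance M K} {Ω : Type*} [MeasurableSpace Ω] {P : Measure Ω}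
  (E : Environment I P) (τ : TieBreak M K)

/-- The randomness of round `t`. -/
def round (t : ℕ) (ω : Ω) : Round M K := (E.X t ω, E.coin t ω, E.unif t ω)

/-- The randomness of the first `n` rounds. -/
def hist (n : ℕ) (ω : Ω) : (Finset.Icc 1 n) → Round M K := fun i => E.round i ω

lemma measurable_round (t : ℕ) : Measurable (E.round t) :=
  (E.measurable_X t).prodMk ((E.measurable_coin t).prodMk (E.measurable_unif t))

lemma measurable_hist (n : ℕ) : Measurable (E.hist n) :=
  measurable_pi_lambda _ fun i => E.measurable_round i

/-- Histories form a finite type, so factoring the statistics through them makes every functional of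
the statistics measurable and bounded. -/
lemma exists_stats_eq (n : ℕ) :
    ∃ Φ : ((Finset.Icc 1 n) → Round M K) → Stats M K, ∀ ω, E.stats τ n ω = Φ (E.hist n ω) := by
  induction n with
  | zero => exact ⟨fun _ => ⟨fun _ => 0, fun _ => 0⟩, fun ω => rfl⟩
  | succ n ih =>
    obtain ⟨Φ, hΦ⟩ := ih
    refine ⟨fun h =>
      let r := h ⟨n + 1, by simp⟩
      τ.step (n + 1) (Φ fun i => h ⟨i, by
        have := Finset.mem_Icc.1 i.2; simp only [Finset.mem_Icc]; omega⟩) r.1 r.2.1 r.2.2,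
      fun ω => ?_⟩
    simp only [stats, hΦ]
    rfl

lemma indepFun_hist_round (n : ℕ) : IndepFun (E.hist n) (E.round (n + 1)) P := by
  have h := E.indep_rounds.indepFun_finset (Finset.Icc 1 n) {n + 1} (by simp) E.measurable_round
  exact h.comp (φ := id) (ψ := fun f : ({n + 1} : Finset ℕ) → Round M K => f ⟨n + 1, by simp⟩) measurable_id 
    (measurable_pi_apply (⟨n + 1, by simp⟩ : ({n + 1} : Finset ℕ)))

lemma measurable_comp_stats {β : Type*} [MeasurableSpace β] (n : ℕ)
    (F : Stats M K → Round M K → β) :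
    Measurable fun ω => F (E.stats τ n ω) (E.round (n + 1) ω) := by
  obtain ⟨Φ, hΦ⟩ := E.exists_stats_eq τ n
  simp only [hΦ]
  exact (measurable_of_finite (f := fun q : ((Finset.Icc 1 n) → Round M K) × Round M K =>
    F (Φ q.1) q.2)).comp ((E.measurable_hist n).prodMk (E.measurable_round (n + 1)))

variable [IsProbabilityMeasure P]

lemma integrable_comp_stats (n : ℕ) (F : Stats M K → Round M K → ℝ) :
    Integrable (fun ω => F (E.stats τ n ω) (E.round (n + 1) ω)) P := by
  have hm := E.measurable_comp_stats τ n F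
  obtain ⟨Φ, hΦ⟩ := E.exists_stats_eq τ n
  obtain ⟨B, hB⟩ := (Set.finite_range fun q : ((Finset.Icc 1 n) → Round M K) × Round M K =>
    ‖F (Φ q.1) q.2‖).bddAbove
  refine Integrable.of_bound hm.aestronglyMeasurable B (Filter.Eventually.of_forall fun ω => ?_)
  rw [hΦ]
  exact hB ⟨(E.hist n ω, E.round (n + 1) ω), rfl⟩

lemma integral_stats_mul_reward (n : ℕ) (F : Stats M K → Bool → Matching M K → ℝ)
    (g : (Fin M → Fin K → Bool) → ℝ) :
    ∫ ω, F (E.stats τ n ω) (E.coin (n + 1) ω) (E.unif (n + 1) ω) * g (E.X (n + 1) ω) ∂P =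
      (∫ ω, F (E.stats τ n ω) (E.coin (n + 1) ω) (E.unif (n + 1) ω) ∂P) *
        ∫ ω, g (E.X (n + 1) ω) ∂P := by
  obtain ⟨Φ, hΦ⟩ := E.exists_stats_eq τ n
  simp only [hΦ]
  have hC : Measurable fun ω => (E.coin (n + 1) ω, E.unif (n + 1) ω) :=
    (E.measurable_coin _).prodMk (E.measurable_unif _)
  have h := indepFun_prodMk_of_indepFun (E.measurable_hist n) (E.measurable_X (n + 1)) hC
    (E.indepFun_hist_round n) (E.indep_X (n + 1))
  exact h.integral_comp_mul_comp
    (f := fun q : ((Finset.Icc 1 n) → Round M K) × (Bool × Matching M K) => F (Φ q.1) q.2.1 q.2.2)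
    (g := g)
    ((E.measurable_hist n).prodMk hC).aemeasurable (E.measurable_X (n + 1)).aemeasurable
    (measurable_of_finite _).aestronglyMeasurable (measurable_of_finite _).aestronglyMeasurable

omit [IsProbabilityMeasure P] in
lemma measureReal_stats_and_coin (n : ℕ) (p : Stats M K → Prop) (q : Bool → Matching M K → Prop) :
    P.real {ω | p (E.stats τ n ω) ∧ q (E.coin (n + 1) ω) (E.unif (n + 1) ω)} =
      P.real {ω | p (E.stats τ n ω)} *
        P.real {ω | q (E.coin (n + 1) ω) (E.unif (n + 1) ω)} := by
  obtain ⟨Φ, hΦ⟩ := E.exists_stats_eq τ n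
  simp only [hΦ]
  have h := (E.indepFun_hist_round n).measure_inter_preimage_eq_mul {h | p (Φ h)}
    {r : Round M K | q r.2.1 r.2.2} (Set.toFinite _).measurableSet (Set.toFinite _).measurableSet
  have h' := congrArg ENNReal.toReal h
  rw [ENNReal.toReal_mul] at h'
  exact h'

end Environment

end HintedBandit

/-! ### Exponential tilting under adaptive observation -/

namespace HintedBandit

lemma measureReal_le_exp_neg_mul_integral {Ω : Type*} [MeasurableSpace Ω] {P : Measure Ω}
    [IsFiniteMeasure P] {A : Set Ω} {f : Ω → ℝ} {c : ℝ} (hf : Integrable f P) (h0 : ∀ ω, 0 ≤ f ω)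
    (h : ∀ ω ∈ A, Real.exp c ≤ f ω) : P.real A ≤ Real.exp (-c) * ∫ ω, f ω ∂P := by
  have h1 := mul_meas_ge_le_integral_of_nonneg (Filter.Eventually.of_forall h0) hf (Real.exp c)
  have h2 : P.real A ≤ P.real {ω | Real.exp c ≤ f ω} := measureReal_mono h
  rw [Real.exp_neg, ← div_eq_inv_mul, le_div_iff₀ (Real.exp_pos c), mul_comm]
  exact (mul_le_mul_of_nonneg_left h2 (Real.exp_pos c).le).trans h1

lemma utility_mem_Icc {M K : ℕ} (G : Matching M K) {r : Fin M → Fin K → ℝ}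
    (hr : ∀ m k, r m k ∈ Set.Icc (0 : ℝ) 1) : utility G r ∈ Set.Icc (0 : ℝ) M := by
  unfold utility
  constructor
  · refine Finset.sum_nonneg fun m _ => ?_
    split_ifs
    · exact (hr _ _).1
    · exact le_rfl
  · refine (Finset.sum_le_sum (g := fun _ => (1 : ℝ)) fun m _ => ?_).trans (by simp)
    split_ifs
    · exact (hr _ _).2
    · exact zero_le_one

lemma toReward_mem_Icc {M K : ℕ} (x : Fin M → Fin K → Bool) (m : Fin M) (k : Fin K) :
    toReward x m k ∈ Set.Icc (0 : ℝ) 1 := by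
  unfold toReward
  split_ifs <;> simp

namespace Environment

variable {M K : ℕ} {I : Instance M K} {Ω : Type*} [MeasurableSpace Ω] {P : Measure Ω}
  (E : Environment I P) (τ : TieBreak M K)

/-- The event that `G` is observed in round `n + 1`. -/
def Obs (n : ℕ) (G : Matching M K) (ω : Ω) : Prop :=
  τ.Observed (n + 1) (E.stats τ n ω) (E.coin (n + 1) ω) (E.unif (n + 1) ω) G

/-- The utility of `G` in round `t`. -/
noncomputable def util (t : ℕ) (G : Matching M K) (ω : Ω) : ℝ := utility G (toReward (E.X t ω))

open Classical in
lemma stats_succ_count (n : ℕ) (G : Matching M K) (ω : Ω) :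
    (E.stats τ (n + 1) ω).count G =
      (E.stats τ n ω).count G + if E.Obs τ n G ω then 1 else 0 := rfl

open Classical in
lemma stats_succ_total (n : ℕ) (G : Matching M K) (ω : Ω) :
    (E.stats τ (n + 1) ω).total G =
      (E.stats τ n ω).total G + if E.Obs τ n G ω then E.util (n + 1) G ω else 0 := rfl

lemma util_mem_Icc (t : ℕ) (G : Matching M K) (ω : Ω) : E.util t G ω ∈ Set.Icc (0 : ℝ) M :=
  utility_mem_Icc G (toReward_mem_Icc _)

lemma total_mem_Icc (n : ℕ) (G : Matching M K) (ω : Ω) :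
    (E.stats τ n ω).total G ∈ Set.Icc (0 : ℝ) (M * (E.stats τ n ω).count G) := by
  induction n with
  | zero => simp [stats]
  | succ n ih =>
    rw [stats_succ_count, stats_succ_total]
    have := E.util_mem_Icc (n + 1) G ω
    split_ifs
    · push_cast
      constructor
      · linarith [ih.1, this.1]
      · linarith [ih.2, this.2]
    · simpa using ih

lemma count_le (n : ℕ) (G : Matching M K) (ω : Ω) : (E.stats τ n ω).count G ≤ n := by
  induction n with
  | zero => simp [stats]
  | succ n ih =>
    rw [stats_succ_count]
    split_ifs <;> omega

lemma count_mul_empMean (n : ℕ) (G : Matching M K) (ω : Ω) :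
    (E.stats τ n ω).count G * (E.stats τ n ω).empMean G = (E.stats τ n ω).total G := by
  unfold Stats.empMean
  rcases Nat.eq_zero_or_pos ((E.stats τ n ω).count G) with h | h
  · have := E.total_mem_Icc τ n G ω
    rw [h] at this ⊢
    simp at this ⊢
    exact this.symm
  · field_simp

lemma empMean_mem_Icc (n : ℕ) (G : Matching M K) (ω : Ω) :
    (E.stats τ n ω).empMean G ∈ Set.Icc (0 : ℝ) M := by
  have h := E.total_mem_Icc τ n G ω
  exact ⟨div_nonneg h.1 (Nat.cast_nonneg _), div_le_of_le_mul₀ (Nat.cast_nonneg _)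
    (Nat.cast_nonneg _) h.2⟩

lemma measurable_util (t : ℕ) (G : Matching M K) : Measurable (E.util t G) :=
  (measurable_of_finite fun x => utility G (toReward x)).comp (E.measurable_X t)

variable [IsProbabilityMeasure P]

lemma integrable_comp_X (t : ℕ) (g : (Fin M → Fin K → Bool) → ℝ) :
    Integrable (fun ω => g (E.X t ω)) P := by
  obtain ⟨B, hB⟩ := (Set.finite_range fun x => ‖g x‖).bddAbove
  exact Integrable.of_bound ((measurable_of_finite g).comp (E.measurable_X t)).aestronglyMeasurable
    B (Filter.Eventually.of_forall fun ω => hB ⟨E.X t ω, rfl⟩)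

lemma integral_util (t : ℕ) (G : Matching M K) : ∫ ω, E.util t G ω ∂P = utility G I.mean := by
  unfold util utility
  rw [integral_finsetSum _ fun m _ => E.integrable_comp_X t fun x =>
    if ∀ m', m' ≠ m → G m' ≠ G m then toReward x m (G m) else 0]
  refine Finset.sum_congr rfl fun m _ => ?_
  split_ifs
  · have hm : MeasurableSet {ω | E.X t ω m (G m) = true} :=
      E.measurable_X t (Set.toFinite {x : Fin M → Fin K → Bool | x m (G m) = true}).measurableSet
    rw [← E.law_X t, ← integral_indicator_one hm]
    refine integral_congr_ae (Filter.Eventually.of_forall fun ω => ?_)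
    simp [toReward, Set.indicator_apply]
  · simp

/-- Hoeffding's lemma for the whole utility, a variable in `[0, M]`; no independence between edges
of one round is needed. -/
lemma integral_exp_util_le (t : ℕ) (G : Matching M K) (l : ℝ) :
    ∫ ω, Real.exp (l * E.util t G ω) ∂P ≤
      Real.exp (l * utility G I.mean + l ^ 2 * M ^ 2 / 8) := by
  have h := (hasSubgaussianMGF_of_mem_Icc (μ := P) (E.measurable_util t G).aemeasurable
    (Filter.Eventually.of_forall (E.util_mem_Icc t G))).mgf_le l
  rw [E.integral_util] at h
  have h1 : ∫ ω, Real.exp (l * E.util t G ω) ∂P =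
      Real.exp (l * utility G I.mean) *
        mgf (fun ω => E.util t G ω - utility G I.mean) P l := by
    rw [mgf, ← integral_const_mul]
    refine integral_congr_ae (Filter.Eventually.of_forall fun ω => ?_)
    simp only [← Real.exp_add]
    ring_nf
  rw [h1, Real.exp_add]
  refine mul_le_mul_of_nonneg_left (h.trans_eq ?_) (Real.exp_pos _).le
  congr 1
  simp
  ring

/-- By convexity of `exp`, a `[0, 1]`-valued variable has a moment generating function dominated by
that of the Bernoulli law with the same mean. -/
lemma integral_exp_util_le_bernoulli (hM : 1 ≤ M) (t : ℕ) (G : Matching M K) (l : ℝ) :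
    ∫ ω, Real.exp (l / M * E.util t G ω) ∂P ≤
      Real.exp (Real.log (1 - utility G I.mean / M + utility G I.mean / M * Real.exp l)) := by
  have hM0 : (0 : ℝ) < M := by exact_mod_cast hM
  have hu := utility_mem_Icc G I.mean_mem
  rw [Real.exp_log (one_sub_add_mul_exp_pos ⟨div_nonneg hu.1 hM0.le, (div_le_one hM0).2 hu.2⟩ l)]
  have hint : Integrable (fun ω => E.util t G ω) P :=
    E.integrable_comp_X t fun x => utility G (toReward x)
  have h1 : ∀ ω, Real.exp (l / M * E.util t G ω) ≤ 1 + (Real.exp l - 1) / M * E.util t G ω := by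
    intro ω
    have hω := E.util_mem_Icc t G ω
    have hy0 : 0 ≤ E.util t G ω / M := div_nonneg hω.1 hM0.le
    have hy1 : E.util t G ω / M ≤ 1 := (div_le_one hM0).2 hω.2
    have := convexOn_exp.2 (Set.mem_univ 0) (Set.mem_univ l) (sub_nonneg.2 hy1) hy0 (by ring)
    simp only [smul_eq_mul, mul_zero, zero_add, Real.exp_zero, mul_one] at this
    calc Real.exp (l / M * E.util t G ω) = Real.exp (E.util t G ω / M * l) := by ring_nf
      _ ≤ _ := this
      _ = _ := by ring
  have hint' : Integrable (fun ω => 1 + (Real.exp l - 1) / M * E.util t G ω) P :=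
    (integrable_const 1).add (hint.const_mul _)
  refine (integral_mono (E.integrable_comp_X t fun x => Real.exp (l / M * utility G (toReward x)))
    hint' h1).trans_eq ?_
  rw [integral_add (integrable_const 1) (hint.const_mul _), integral_const_mul, E.integral_util]
  simp
  ring

open Classical in
/-- Exponential tilting: the tilted weights of the rounds in which `G` is observed for the
`(k + 1)`-th time, plus the tilted weight of the runs with at most `k` observations, have total
mass at most one. -/
lemma sum_integral_tilt_le_one (G : Matching M K) {l ψ : ℝ}
    (hψ : ∀ t, ∫ ω, Real.exp (l * E.util t G ω) ∂P ≤ Real.exp ψ) (k T : ℕ) :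
    (∑ n ∈ Finset.range T, ∫ ω, (if E.Obs τ n G ω ∧ (E.stats τ n ω).count G = k then
        Real.exp (l * (E.stats τ n ω).total G - ψ * k) else 0) ∂P) +
      ∫ ω, (if (E.stats τ T ω).count G ≤ k then
        Real.exp (l * (E.stats τ T ω).total G - ψ * (E.stats τ T ω).count G) else 0) ∂P ≤ 1 := by
  induction T with
  | zero => simp [stats]
  | succ n ih =>
    refine le_trans ?_ ih
    rw [Finset.sum_range_succ, add_assoc]
    refine add_le_add_right ?_ _
    let W : Stats M K → ℝ := fun s => Real.exp (l * s.total G - ψ * s.count G)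
    -- The mass at count at most `k` splits in three: `A` is unobserved and unchanged; `B` is
    -- observed below count `k` and gets multiplied by `g`, of mean at most one; `D` is observed at
    -- count `k` and moves to the sum for good.
    let A : Stats M K → Bool → Matching M K → ℝ := fun s b V =>
      if s.count G ≤ k ∧ ¬ τ.Observed (n + 1) s b V G then W s else 0
    let B : Stats M K → Bool → Matching M K → ℝ := fun s b V =>
      if s.count G < k ∧ τ.Observed (n + 1) s b V G then W s else 0
    let D : Stats M K → Bool → Matching M K → ℝ := fun s b V =>
      if τ.Observed (n + 1) s b V G ∧ s.count G = k then
        Real.exp (l * s.total G - ψ * k) else 0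
    let g : (Fin M → Fin K → Bool) → ℝ := fun x => Real.exp (l * utility G (toReward x) - ψ)
    have iA : Integrable (fun ω => A (E.stats τ n ω) (E.coin (n + 1) ω) (E.unif (n + 1) ω)) P :=
      E.integrable_comp_stats τ n fun s r => A s r.2.1 r.2.2
    have iB : Integrable (fun ω => B (E.stats τ n ω) (E.coin (n + 1) ω) (E.unif (n + 1) ω)) P :=
      E.integrable_comp_stats τ n fun s r => B s r.2.1 r.2.2
    have iD : Integrable (fun ω => D (E.stats τ n ω) (E.coin (n + 1) ω) (E.unif (n + 1) ω)) P :=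
      E.integrable_comp_stats τ n fun s r => D s r.2.1 r.2.2
    have iAB : Integrable (fun ω => A (E.stats τ n ω) (E.coin (n + 1) ω) (E.unif (n + 1) ω) +
        B (E.stats τ n ω) (E.coin (n + 1) ω) (E.unif (n + 1) ω)) P := iA.add iB
    have iBg : Integrable (fun ω => B (E.stats τ n ω) (E.coin (n + 1) ω) (E.unif (n + 1) ω) *
        g (E.X (n + 1) ω)) P :=
      E.integrable_comp_stats τ n fun s r => B s r.2.1 r.2.2 * g r.1
    have hsplit : ∀ ω, (if (E.stats τ (n + 1) ω).count G ≤ k then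
        Real.exp (l * (E.stats τ (n + 1) ω).total G - ψ * (E.stats τ (n + 1) ω).count G) else 0) =
        A (E.stats τ n ω) (E.coin (n + 1) ω) (E.unif (n + 1) ω) +
        B (E.stats τ n ω) (E.coin (n + 1) ω) (E.unif (n + 1) ω) * g (E.X (n + 1) ω) := by
      intro ω
      rw [stats_succ_count, stats_succ_total]
      by_cases ho : E.Obs τ n G ω
      · have ho' : τ.Observed (n + 1) (E.stats τ n ω) (E.coin (n + 1) ω) (E.unif (n + 1) ω) G := ho
        simp only [ho, ho', A, B, g, W, if_true, not_true, and_false, if_false, zero_add, and_true,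
          Nat.succ_le_iff]
        split_ifs
        · rw [← Real.exp_add]
          congr 1
          push_cast
          simp only [util]
          ring
        · simp
      · have ho' : ¬ τ.Observed (n + 1) (E.stats τ n ω) (E.coin (n + 1) ω) (E.unif (n + 1) ω) G :=
          ho
        simp [ho, ho', A, B, W]
    have hg : ∫ ω, g (E.X (n + 1) ω) ∂P ≤ 1 := by
      have : ∀ ω, g (E.X (n + 1) ω) = Real.exp (l * E.util (n + 1) G ω) * Real.exp (-ψ) := by
        intro ω
        simp only [g, util, ← Real.exp_add, sub_eq_add_neg]
      simp only [this]
      rw [integral_mul_const]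
      calc _ ≤ Real.exp ψ * Real.exp (-ψ) :=
            mul_le_mul_of_nonneg_right (hψ _) (Real.exp_pos _).le
        _ = 1 := by rw [← Real.exp_add]; simp
    have hB0 : 0 ≤ ∫ ω, B (E.stats τ n ω) (E.coin (n + 1) ω) (E.unif (n + 1) ω) ∂P := by
      refine integral_nonneg fun ω => ?_
      simp only [B, W]
      split_ifs
      · exact (Real.exp_pos _).le
      · exact le_rfl
    have hsum : ∀ ω, (if (E.stats τ n ω).count G ≤ k then
        Real.exp (l * (E.stats τ n ω).total G - ψ * (E.stats τ n ω).count G) else 0) =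
        D (E.stats τ n ω) (E.coin (n + 1) ω) (E.unif (n + 1) ω) +
        (A (E.stats τ n ω) (E.coin (n + 1) ω) (E.unif (n + 1) ω) +
        B (E.stats τ n ω) (E.coin (n + 1) ω) (E.unif (n + 1) ω)) := by
      intro ω
      simp only [A, B, D, W]
      by_cases ho : τ.Observed (n + 1) (E.stats τ n ω) (E.coin (n + 1) ω) (E.unif (n + 1) ω) G
      · rcases lt_trichotomy ((E.stats τ n ω).count G) k with h | h | h
        · simp [ho, h, h.le, h.ne]
        · simp [ho, h]
        · simp [ho, h.not_ge, h.ne', h.le.not_gt]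
      · simp [ho]
    simp only [hsplit, hsum]
    rw [integral_add iA iBg, integral_stats_mul_reward, integral_add iD iAB,
      integral_add iA iB]
    refine add_le_add le_rfl (add_le_add le_rfl ?_)
    exact mul_le_of_le_one_right hB0 hg

end Environment

end HintedBandit

/-! ### Concentration, and charging rounds to observations -/

namespace HintedBandit

lemma sum_exp_neg_mul_le {a : ℝ} (ha : 0 < a) (R : ℕ) :
    ∑ k ∈ Finset.range R, Real.exp (-(a * k)) ≤ 1 + 1 / a := by
  have h1 : Real.exp (-a) < 1 := by rw [Real.exp_lt_one_iff]; linarith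
  have h2 : ∀ k : ℕ, Real.exp (-(a * k)) = Real.exp (-a) ^ k := fun k => by
    rw [← Real.exp_nat_mul]; ring_nf
  simp only [h2]
  have h3 := mul_neg_geom_sum (Real.exp (-a)) R
  have h4 : 0 < Real.exp (-a) ^ R := by positivity
  have h5 : Real.exp (-a) * (1 + a) ≤ 1 := by
    have := Real.add_one_le_exp a
    calc Real.exp (-a) * (1 + a) ≤ Real.exp (-a) * Real.exp a :=
          mul_le_mul_of_nonneg_left (by linarith) (Real.exp_pos _).le
      _ = 1 := by rw [← Real.exp_add]; simp
  have h6 : 1 ≤ (1 - Real.exp (-a)) * (1 + 1 / a) := by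
    have : (1 - Real.exp (-a)) * (1 + 1 / a) = (1 + a - Real.exp (-a) * (1 + a)) / a := by
      field_simp
      ring
    rw [this, le_div_iff₀ ha]
    linarith
  by_contra hcon
  push Not at hcon
  have := mul_lt_mul_of_pos_left hcon (show 0 < 1 - Real.exp (-a) by linarith)
  linarith

namespace Environment

variable {M K : ℕ} {I : Instance M K} {Ω : Type*} [MeasurableSpace Ω] {P : Measure Ω}
  (E : Environment I P) (τ : TieBreak M K) [IsProbabilityMeasure P]

lemma sum_measureReal_obs_le_exp (G : Matching M K) {l ψ : ℝ}
    (hψ : ∀ t, ∫ ω, Real.exp (l * E.util t G ω) ∂P ≤ Real.exp ψ) (k T : ℕ) (c : ℝ) :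
    ∑ n ∈ Finset.range T, P.real {ω | E.Obs τ n G ω ∧ (E.stats τ n ω).count G = k ∧
      c ≤ l * (E.stats τ n ω).total G - ψ * k} ≤ Real.exp (-c) := by
  classical
  have h := E.sum_integral_tilt_le_one τ G hψ k T
  have h0 : 0 ≤ ∫ ω, (if (E.stats τ T ω).count G ≤ k then
      Real.exp (l * (E.stats τ T ω).total G - ψ * (E.stats τ T ω).count G) else 0) ∂P := by
    refine integral_nonneg fun ω => ?_
    dsimp only
    split_ifs <;> positivity
  have h1 : ∑ n ∈ Finset.range T, ∫ ω, (if E.Obs τ n G ω ∧ (E.stats τ n ω).count G = k then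
      Real.exp (l * (E.stats τ n ω).total G - ψ * k) else 0) ∂P ≤ 1 := by linarith
  calc _ ≤ ∑ n ∈ Finset.range T, Real.exp (-c) *
        ∫ ω, (if E.Obs τ n G ω ∧ (E.stats τ n ω).count G = k then
          Real.exp (l * (E.stats τ n ω).total G - ψ * k) else 0) ∂P := by
        refine Finset.sum_le_sum fun n _ => measureReal_le_exp_neg_mul_integral
          (E.integrable_comp_stats τ n fun s r =>
            if τ.Observed (n + 1) s r.2.1 r.2.2 G ∧ s.count G = k then
              Real.exp (l * s.total G - ψ * k) else 0) (fun ω => ?_) ?_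
        · split_ifs <;> positivity
        · rintro ω ⟨h2, h3, h4⟩
          rw [if_pos ⟨h2, h3⟩]
          exact Real.exp_le_exp.2 h4
    _ ≤ Real.exp (-c) * 1 := by
        rw [← Finset.mul_sum]
        exact mul_le_mul_of_nonneg_left h1 (Real.exp_pos _).le
    _ = _ := mul_one _

lemma measureReal_count_le_exp (G : Matching M K) {l ψ : ℝ}
    (hψ : ∀ t, ∫ ω, Real.exp (l * E.util t G ω) ∂P ≤ Real.exp ψ) (k n : ℕ) (c : ℝ) :
    P.real {ω | (E.stats τ n ω).count G = k ∧
      c ≤ l * (E.stats τ n ω).total G - ψ * k} ≤ Real.exp (-c) := by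
  classical
  have h := E.sum_integral_tilt_le_one τ G hψ k n
  have h0 : 0 ≤ ∑ j ∈ Finset.range n, ∫ ω,
      (if E.Obs τ j G ω ∧ (E.stats τ j ω).count G = k then
      Real.exp (l * (E.stats τ j ω).total G - ψ * k) else 0) ∂P := by
    refine Finset.sum_nonneg fun j _ => integral_nonneg fun ω => ?_
    dsimp only
    split_ifs <;> positivity
  refine (measureReal_le_exp_neg_mul_integral (c := c) (E.integrable_comp_stats τ n fun s _ =>
      if s.count G ≤ k then Real.exp (l * s.total G - ψ * s.count G) else 0) (fun ω => ?_)
      ?_).trans (mul_le_of_le_one_right (Real.exp_pos _).le (by linarith))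
  · split_ifs <;> positivity
  · rintro ω ⟨h2, h3⟩
    rw [if_pos h2.le, h2]
    exact Real.exp_le_exp.2 h3

lemma sum_measureReal_obs_le (G : Matching M K) (T R : ℕ) (Q : ℕ → Ω → Prop) (b : ℕ → ℝ)
    (hR : ∀ n < T, ∀ ω, Q n ω → (E.stats τ n ω).count G < R)
    (hb : ∀ k, ∑ n ∈ Finset.range T,
      P.real {ω | E.Obs τ n G ω ∧ Q n ω ∧ (E.stats τ n ω).count G = k} ≤ b k) :
    ∑ n ∈ Finset.range T, P.real {ω | E.Obs τ n G ω ∧ Q n ω} ≤ ∑ k ∈ Finset.range R, b k := by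
  calc _ ≤ ∑ n ∈ Finset.range T, ∑ k ∈ Finset.range R,
        P.real {ω | E.Obs τ n G ω ∧ Q n ω ∧ (E.stats τ n ω).count G = k} := by
        refine Finset.sum_le_sum fun n hn => le_trans (measureReal_mono ?_ (measure_ne_top _ _))
          (measureReal_biUnion_finset_le (Finset.range R) _)
        rintro ω ⟨h1, h2⟩
        simp only [Set.mem_iUnion]
        exact ⟨_, Finset.mem_range.2 (hR n (Finset.mem_range.1 hn) ω h2), h1, h2, rfl⟩
    _ = _ := Finset.sum_comm
    _ ≤ _ := Finset.sum_le_sum fun k _ => hb k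

lemma sum_measureReal_obs_count_lt_le (G : Matching M K) (T R : ℕ) :
    ∑ n ∈ Finset.range T, P.real {ω | E.Obs τ n G ω ∧ (E.stats τ n ω).count G < R} ≤ R := by
  refine (E.sum_measureReal_obs_le τ G T R _ (fun _ => 1) (fun _ _ _ h => h) fun k => ?_).trans
    (by simp)
  -- The trivial tilt expresses that the `(k + 1)`-th observation happens at most once.
  have h := E.sum_measureReal_obs_le_exp τ G (l := 0) (ψ := 0) (by simp) k T 0
  simp only [neg_zero, Real.exp_zero] at h
  refine le_trans (Finset.sum_le_sum fun n _ => measureReal_mono ?_ (measure_ne_top _ _)) h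
  rintro ω ⟨h1, -, h3⟩
  exact ⟨h1, h3, by simp⟩

omit [IsProbabilityMeasure P] in
-- The slope `4 δ / M²` maximizes `l δ - l² M² / 8`, with value `2 δ² / M²`; the sign `s` treats
-- both tails at once.
lemma le_tilt_of_deviation (hM : 1 ≤ M) (G : Matching M K) {δ s : ℝ} (hδ : 0 < δ) (hs : s ^ 2 = 1)
    (n : ℕ) (ω : Ω)
    (h : δ ≤ s * ((E.stats τ n ω).empMean G - utility G I.mean)) :
    2 * δ ^ 2 / M ^ 2 * (E.stats τ n ω).count G ≤
      (s * (4 * δ / M ^ 2)) * (E.stats τ n ω).total G -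
        ((s * (4 * δ / M ^ 2)) * utility G I.mean + (s * (4 * δ / M ^ 2)) ^ 2 * M ^ 2 / 8) *
          (E.stats τ n ω).count G := by
  have hM0 : (0 : ℝ) < M := by exact_mod_cast hM
  rw [← E.count_mul_empMean τ n G ω]
  set N : ℝ := ((E.stats τ n ω).count G : ℝ)
  set x := (E.stats τ n ω).empMean G
  have h1 : (s * (4 * δ / M ^ 2)) ^ 2 * M ^ 2 / 8 = 2 * δ ^ 2 / M ^ 2 := by
    rw [mul_pow, hs]; field_simp; ring
  rw [h1]
  have h2 : N * (4 * δ / M ^ 2) * δ ≤ N * (4 * δ / M ^ 2) * (s * (x - utility G I.mean)) :=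
    mul_le_mul_of_nonneg_left h (by positivity)
  have h3 : N * (4 * δ / M ^ 2) * δ = 2 * (2 * δ ^ 2 / M ^ 2 * N) := by ring
  linarith

lemma sum_measureReal_obs_deviation_le (hM : 1 ≤ M) (G : Matching M K) {δ s : ℝ} (hδ : 0 < δ)
    (hs : s ^ 2 = 1) (T : ℕ) :
    ∑ n ∈ Finset.range T, P.real {ω | E.Obs τ n G ω ∧
      δ ≤ s * ((E.stats τ n ω).empMean G - utility G I.mean)} ≤ 1 + M ^ 2 / (2 * δ ^ 2) := by
  have hM0 : (0 : ℝ) < M := by exact_mod_cast hM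
  have ha : 0 < 2 * δ ^ 2 / (M : ℝ) ^ 2 := by positivity
  refine (E.sum_measureReal_obs_le τ G T T _ (fun k => Real.exp (-(2 * δ ^ 2 / M ^ 2 * k)))
    (fun n hn ω _ => (E.count_le τ n G ω).trans_lt hn) fun k => ?_).trans
    ((sum_exp_neg_mul_le ha T).trans_eq (by rw [one_div_div]))
  refine le_trans (Finset.sum_le_sum fun n _ => measureReal_mono ?_ (measure_ne_top _ _))
    (E.sum_measureReal_obs_le_exp τ G
      (fun t => E.integral_exp_util_le t G (s * (4 * δ / M ^ 2))) k T _)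
  rintro ω ⟨h1, h2, h3⟩
  have := E.le_tilt_of_deviation τ hM G hδ hs n ω h2
  rw [h3] at this
  exact ⟨h1, h3, this⟩

lemma measureReal_deviation_le (hM : 1 ≤ M) (G : Matching M K) {δ s : ℝ} (hδ : 0 < δ)
    (hs : s ^ 2 = 1) (n k : ℕ) :
    P.real {ω | (E.stats τ n ω).count G = k ∧
      δ ≤ s * ((E.stats τ n ω).empMean G - utility G I.mean)} ≤
        Real.exp (-(2 * δ ^ 2 / M ^ 2 * k)) := by
  refine le_trans (measureReal_mono ?_ (measure_ne_top _ _))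
    (E.measureReal_count_le_exp τ G
      (fun t => E.integral_exp_util_le t G (s * (4 * δ / M ^ 2))) k n _)
  rintro ω ⟨h2, h3⟩
  have := E.le_tilt_of_deviation τ hM G hδ hs n ω h3
  rw [h2] at this
  exact ⟨h2, this⟩

/-- Chernoff bound for the divergence of the empirical mean after `k` observations. -/
lemma measureReal_klBer_le (hM : 1 ≤ M) (G : Matching M K) (hG : 0 < utility G I.mean)
    {δ f : ℝ} (hδ : 0 < δ) (hf : 0 ≤ f) (n k : ℕ) (hk : 0 < k) :
    P.real {ω | (E.stats τ n ω).count G = k ∧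
      (E.stats τ n ω).empMean G ≤ utility G I.mean - δ ∧
      (f : EReal) < ((k : ℝ) : EReal) *
        klBer ((E.stats τ n ω).empMean G / M) (utility G I.mean / M)} ≤ Real.exp (1 - f) := by
  have hM0 : (0 : ℝ) < M := by exact_mod_cast hM
  have hk0 : (0 : ℝ) < k := by exact_mod_cast hk
  have hu := utility_mem_Icc G I.mean_mem
  set p := utility G I.mean / M with hp
  -- The loss `1 / k` per observation adds up to `1` over `k` observations, hence the factor `e` in
  -- the bound.
  obtain ⟨l, hl⟩ := exists_tilt (p := p) (c := f / k) (η := δ / M) (ε := 1 / k)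
    (div_pos hG hM0) ((div_le_one hM0).2 hu.2) (by positivity) (by positivity) (by positivity)
  refine le_trans (measureReal_mono ?_ (measure_ne_top _ _))
    ((E.measureReal_count_le_exp τ G
      (fun t => E.integral_exp_util_le_bernoulli hM t G l) k n (f - 1)).trans_eq
        (by rw [neg_sub]))
  rintro ω ⟨h1, h2, h3⟩
  refine ⟨h1, ?_⟩
  have hx := E.empMean_mem_Icc τ n G ω
  rw [← E.count_mul_empMean τ n G ω, h1]
  set x := (E.stats τ n ω).empMean G
  have h4 : ((f / k : ℝ) : EReal) < klBer (x / M) p := by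
    by_contra hcon
    push Not at hcon
    have h5 : ((k : ℝ) : EReal) * klBer (x / M) p ≤ ((k : ℝ) : EReal) * ((f / k : ℝ) : EReal) :=
      mul_le_mul_of_nonneg_left hcon (by exact_mod_cast hk0.le)
    rw [← EReal.coe_mul, mul_div_cancel₀ _ hk0.ne'] at h5
    exact absurd h3 (not_lt.2 h5)
  have h5 := hl (x / M) (div_nonneg hx.1 hM0.le)
    (by rw [hp, ← sub_div]; exact div_le_div_of_nonneg_right h2 hM0.le) h4
  have h6 := mul_le_mul_of_nonneg_left h5 hk0.le
  have h7 : (k : ℝ) * (f / k - 1 / k) = f - 1 := by field_simp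
  rw [h7] at h6
  calc f - 1 ≤ _ := h6
    _ = _ := by ring

/-- Every matching is hinted with conditional probability at least `1 / (2 K ^ M)`. -/
lemma measureReal_asks_le_unif (hK : 0 < K) (n : ℕ) (G : Matching M K) (Q : Stats M K → Prop) :
    P.real {ω | τ.Asks (n + 1) (E.stats τ n ω) ∧ Q (E.stats τ n ω)} ≤
      2 * K ^ M * P.real {ω | E.Obs τ n G ω ∧ Q (E.stats τ n ω)} := by
  have h := E.measureReal_stats_and_coin τ n (fun s => τ.Asks (n + 1) s ∧ Q s)
    (fun b V => b = false ∧ V = G)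
  have h1 : P.real {ω | E.coin (n + 1) ω = false ∧ E.unif (n + 1) ω = G} =
      1 / 2 * (1 / (K : ℝ) ^ M) := by
    have hi := congrArg ENNReal.toReal ((E.indep_coin (n + 1)).measure_inter_preimage_eq_mul {false}
      {G} (Set.toFinite _).measurableSet (Set.toFinite _).measurableSet)
    rw [ENNReal.toReal_mul] at hi
    have hc : P.real {ω | E.coin (n + 1) ω = false} = 1 / 2 := by
      have hm : MeasurableSet {ω | E.coin (n + 1) ω = true} :=
        E.measurable_coin (n + 1) (Set.toFinite {true}).measurableSet
      have := probReal_compl_eq_one_sub (μ := P) hm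
      rw [E.law_coin] at this
      have he : {ω | E.coin (n + 1) ω = true}ᶜ = {ω | E.coin (n + 1) ω = false} := by
        ext ω; simp
      rw [he] at this
      rw [this]; norm_num
    calc _ = P.real {ω | E.coin (n + 1) ω = false} * P.real {ω | E.unif (n + 1) ω = G} := hi
      _ = _ := by rw [hc, E.law_unif]
  rw [h1] at h
  have h2 : P.real {ω | (τ.Asks (n + 1) (E.stats τ n ω) ∧ Q (E.stats τ n ω)) ∧
      E.coin (n + 1) ω = false ∧ E.unif (n + 1) ω = G} ≤
      P.real {ω | E.Obs τ n G ω ∧ Q (E.stats τ n ω)} := by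
    refine measureReal_mono ?_ (measure_ne_top _ _)
    rintro ω ⟨⟨h1, h2⟩, h3, h4⟩
    exact ⟨Or.inr ⟨h1, by simp [h3, h4]⟩, h2⟩
  rw [h] at h2
  have hK0 : (0 : ℝ) < (K : ℝ) ^ M := by positivity
  have h3 := mul_le_mul_of_nonneg_left h2 (show 0 ≤ 2 * (K : ℝ) ^ M by positivity)
  refine le_trans (le_of_eq ?_) h3
  field_simp

/-- The coin alone reveals the candidate, so the price is `2` instead of `2 K ^ M`; this keeps the
leading term of the hint count at `K ^ M`. -/
lemma measureReal_asks_le_candidate (n : ℕ) (G : Matching M K) (Q : Stats M K → Prop) :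
    P.real {ω | τ.Asks (n + 1) (E.stats τ n ω) ∧ τ.candidate (n + 1) (E.stats τ n ω) = G ∧
      Q (E.stats τ n ω)} ≤ 2 * P.real {ω | E.Obs τ n G ω ∧ Q (E.stats τ n ω)} := by
  have h := E.measureReal_stats_and_coin τ n (fun s => τ.Asks (n + 1) s ∧
    τ.candidate (n + 1) s = G ∧ Q s) (fun b _ => b = true)
  rw [E.law_coin] at h
  have h2 : P.real {ω | (τ.Asks (n + 1) (E.stats τ n ω) ∧
      τ.candidate (n + 1) (E.stats τ n ω) = G ∧ Q (E.stats τ n ω)) ∧ E.coin (n + 1) ω = true} ≤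
      P.real {ω | E.Obs τ n G ω ∧ Q (E.stats τ n ω)} := by
    refine measureReal_mono ?_ (measure_ne_top _ _)
    rintro ω ⟨⟨h1, h2, h3⟩, h4⟩
    exact ⟨Or.inr ⟨h1, by rw [h4, if_pos rfl, h2]⟩, h3⟩
  linarith

end Environment

end HintedBandit

/-! ### Failures of the kl-UCB index -/

namespace HintedBandit

lemma one_le_log {t : ℕ} (ht : 3 ≤ t) : 1 ≤ Real.log t := by
  have ht' : (3 : ℝ) ≤ t := by exact_mod_cast ht
  rw [Real.le_log_iff_exp_le (by linarith)]
  linarith [Real.exp_one_lt_d9]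

lemma explore_nonneg {t : ℕ} (ht : 3 ≤ t) : 0 ≤ explore t := by
  have := one_le_log ht
  have := Real.log_nonneg this
  unfold explore
  linarith

lemma explore_le (t : ℕ) : explore t ≤ 5 * Real.log t := by
  have := Real.log_le_self (Real.log_natCast_nonneg t)
  unfold explore
  linarith

lemma exp_neg_explore {t : ℕ} (ht : 3 ≤ t) :
    Real.exp (-explore t) = 1 / (t * Real.log t ^ 4) := by
  have hL := one_le_log ht
  have ht' : (0 : ℝ) < t := by exact_mod_cast (by omega : 0 < t)
  have : explore t = Real.log (t * Real.log t ^ 4) := by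
    rw [Real.log_mul ht'.ne' (by positivity), Real.log_pow, explore]
    norm_num
  rw [this, Real.exp_neg, Real.exp_log (by positivity), one_div]

/-- The series telescopes against `1 / log`. The first two terms are bounded by `1` each, and the
rest by `C / log 2 ≤ 2 C`. -/
lemma sum_le_of_le_div_mul_log_sq {g : ℕ → ℝ} {C : ℝ} (hC : 0 ≤ C) (h1 : ∀ n, g n ≤ 1)
    (h2 : ∀ n, 2 ≤ n → g n ≤ C / ((n + 1) * Real.log (n + 1) ^ 2)) (h0 : ∀ n, 0 ≤ g n) (T : ℕ) :
    ∑ n ∈ Finset.range T, g n ≤ 2 + 2 * C := by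
  have key : ∀ j : ℕ, ∑ n ∈ Finset.range (2 + j), g n ≤
      2 + C * (1 / Real.log 2 - 1 / Real.log (2 + j)) := by
    intro j
    induction j with
    | zero =>
      simp only [add_zero, Finset.sum_range_succ, Finset.sum_range_zero, Nat.cast_zero, sub_self,
        mul_zero]
      linarith [h1 0, h1 1]
    | succ j ih =>
      rw [← add_assoc, Finset.sum_range_succ]
      have hg := h2 (2 + j) (by omega)
      set u : ℝ := 2 + j with hu
      have hu2 : (2 : ℝ) ≤ u := by simp [hu]
      have hcast : ((2 + j : ℕ) : ℝ) = u := by push_cast; rfl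
      have hcast' : (2 : ℝ) + ((j + 1 : ℕ) : ℝ) = u + 1 := by push_cast; ring
      rw [hcast] at hg
      rw [hcast']
      have hl : 0 < Real.log u := Real.log_pos (by linarith)
      have hl' : Real.log u ≤ Real.log (u + 1) := Real.log_le_log (by linarith) (by linarith)
      have hd : 1 / (u + 1) ≤ Real.log (u + 1) - Real.log u := by
        rw [← Real.log_div (by linarith) (by linarith)]
        have := Real.one_sub_inv_le_log_of_pos (show 0 < (u + 1) / u by positivity)
        refine le_trans (le_of_eq ?_) this
        field_simp
        ring
      have hstep : 1 / ((u + 1) * Real.log (u + 1) ^ 2) ≤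
          1 / Real.log u - 1 / Real.log (u + 1) := by
        have hlu : 0 < Real.log (u + 1) := hl.trans_le hl'
        rw [div_sub_div _ _ hl.ne' hlu.ne', one_mul, mul_one]
        calc 1 / ((u + 1) * Real.log (u + 1) ^ 2) =
              (1 / (u + 1)) / (Real.log (u + 1) * Real.log (u + 1)) := by field_simp
          _ ≤ (1 / (u + 1)) / (Real.log u * Real.log (u + 1)) := by gcongr
          _ ≤ _ := by gcongr
      have := mul_le_mul_of_nonneg_left hstep hC
      rw [mul_one_div] at this
      linarith
  have hlog2 : 1 / Real.log 2 ≤ 2 := by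
    rw [div_le_iff₀ (Real.log_pos one_lt_two)]
    linarith [Real.log_two_gt_d9]
  have hlog : 0 ≤ 1 / Real.log (2 + T) := by
    have : 0 < Real.log (2 + T) := Real.log_pos (by linarith [Nat.cast_nonneg (α := ℝ) T])
    positivity
  have hmono : ∑ n ∈ Finset.range T, g n ≤ ∑ n ∈ Finset.range (2 + T), g n :=
    Finset.sum_le_sum_of_subset_of_nonneg (Finset.range_mono (by omega)) fun n _ _ => h0 n
  have := mul_le_mul_of_nonneg_left
    (show 1 / Real.log 2 - 1 / Real.log (2 + T) ≤ 2 by linarith) hC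
  linarith [key T]

namespace Instance

variable {M K : ℕ} (I : Instance M K)

lemma minGap_le {G : Matching M K} (hG : G ≠ I.best) :
    I.minGap ≤ utility I.best I.mean - utility G I.mean :=
  ciInf_le (f := fun G : {G : Matching M K // G ≠ I.best} =>
    utility I.best I.mean - utility G.1 I.mean) (Set.finite_range _).bddBelow ⟨G, hG⟩

lemma minGap_le_utility_best (hM : 1 ≤ M) (hK : M < K) : I.minGap ≤ utility I.best I.mean := by
  have : Nonempty (Fin M) := ⟨⟨0, hM⟩⟩
  have : Nontrivial (Fin K) := Fin.nontrivial_iff_two_le.2 (by omega)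
  obtain ⟨G, hG⟩ := exists_ne I.best
  linarith [I.minGap_le hG, (utility_mem_Icc G I.mean_mem).1]

end Instance

lemma mem_argmaxOn {α : Type*} {S : Finset α} {f : α → ℝ} {a : α} :
    a ∈ argmaxOn S f ↔ a ∈ S ∧ ∀ b ∈ S, f b ≤ f a := by
  simp [argmaxOn]

lemma argmaxOn_nonempty {α : Type*} {S : Finset α} (hS : S.Nonempty) (f : α → ℝ) :
    (argmaxOn S f).Nonempty := by
  obtain ⟨a, ha, h⟩ := S.exists_max_image f hS
  exact ⟨a, mem_argmaxOn.2 ⟨ha, h⟩⟩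

namespace TieBreak

variable {M K : ℕ} (τ : TieBreak M K)

lemma empMean_le_pulled (t : ℕ) (s : Stats M K) (G : Matching M K) :
    s.empMean G ≤ s.empMean (τ.pulled t s) :=
  (mem_argmaxOn.1 (τ.pull_mem t s _ (argmaxOn_nonempty ⟨G, Finset.mem_univ G⟩ s.empMean))).2 G
    (Finset.mem_univ G)

lemma index_le_candidate (t : ℕ) (s : Stats M K) {G : Matching M K} (hG : G ≠ τ.pulled t s) :
    s.index t G ≤ s.index t (τ.candidate t s) := by
  have hmem : G ∈ Finset.univ.erase (τ.pulled t s) := Finset.mem_erase.2 ⟨hG, Finset.mem_univ G⟩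
  exact (mem_argmaxOn.1 (τ.cand_mem t s _ (argmaxOn_nonempty ⟨G, hmem⟩ (s.index t)))).2 G hmem

lemma candidate_ne_pulled (hM : 1 ≤ M) (hK : M < K) (t : ℕ) (s : Stats M K) :
    τ.candidate t s ≠ τ.pulled t s := by
  have : Nonempty (Fin M) := ⟨⟨0, hM⟩⟩
  have : Nontrivial (Fin K) := Fin.nontrivial_iff_two_le.2 (by omega)
  obtain ⟨G, hG⟩ := exists_ne (τ.pulled t s)
  have hmem : G ∈ Finset.univ.erase (τ.pulled t s) := Finset.mem_erase.2 ⟨hG, Finset.mem_univ G⟩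
  exact (Finset.mem_erase.1 (mem_argmaxOn.1
    (τ.cand_mem t s _ (argmaxOn_nonempty ⟨G, hmem⟩ (s.index t)))).1).1

end TieBreak

namespace Stats

variable {M K : ℕ} (s : Stats M K)

lemma le_index {t : ℕ} (ht : 2 ≤ t) {G : Matching M K} {q : ℝ} (h0 : 0 ≤ q) (hM : q ≤ M)
    (h : ((s.count G : ℝ) : EReal) * klBer (s.empMean G / M) (q / M) ≤
      ((explore t : ℝ) : EReal)) : q ≤ s.index t G := by
  rw [index, if_neg (by omega)]
  exact le_csSup ⟨M, fun x hx => hx.2.1⟩ ⟨h0, hM, h⟩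

lemma exists_of_lt_index {t : ℕ} {G : Matching M K} {c : ℝ} (hc : 0 ≤ c) (h : c < s.index t G) :
    ∃ q, c < q ∧ q ≤ M ∧ ((s.count G : ℝ) : EReal) * klBer (s.empMean G / M) (q / M) ≤
      ((explore t : ℝ) : EReal) := by
  unfold index at h
  split_ifs at h
  · linarith
  · rcases Set.eq_empty_or_nonempty {q : ℝ | 0 ≤ q ∧ q ≤ M ∧
        ((s.count G : ℝ) : EReal) * klBer (s.empMean G / M) (q / M) ≤
          ((explore t : ℝ) : EReal)} with he | hne
    · rw [he, Real.sSup_empty] at h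
      linarith
    · obtain ⟨q, hq, hcq⟩ := exists_lt_of_lt_csSup hne h
      exact ⟨q, hcq, hq.2.1, hq.2.2⟩

end Stats

namespace Environment

variable {M K : ℕ} {I : Instance M K} {Ω : Type*} [MeasurableSpace Ω] {P : Measure Ω}
  (E : Environment I P) (τ : TieBreak M K) [IsProbabilityMeasure P]

/-- A union bound over the count `k`: below `f / a` each value costs `exp (1 - f)` by the divergence
bound, and beyond it Hoeffding's `exp (-a k)` decays geometrically from `exp (-f)`. The factor in
front is thus of order `f / a`, and not the number of rounds. -/
lemma measureReal_index_lt_le (hM : 1 ≤ M) (G : Matching M K) (hG : 0 < utility G I.mean)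
    {δ : ℝ} (hδ : 0 < δ) (n : ℕ) (hn : 2 ≤ n) :
    P.real {ω | (E.stats τ n ω).empMean G ≤ utility G I.mean - δ ∧
      (E.stats τ n ω).index (n + 1) G < utility G I.mean} ≤
      Real.exp (1 - explore (n + 1)) *
        (2 + (1 + explore (n + 1)) / (2 * δ ^ 2 / M ^ 2)) := by
  have hM0 : (0 : ℝ) < M := by exact_mod_cast hM
  have hu := utility_mem_Icc G I.mean_mem
  set f := explore (n + 1) with hf
  have hf0 : 0 ≤ f := explore_nonneg (by omega)
  set a := 2 * δ ^ 2 / (M : ℝ) ^ 2 with ha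
  have ha0 : 0 < a := by positivity
  set m := ⌈f / a⌉₊ with hm
  have hfm : f / a ≤ m := Nat.le_ceil _
  have hmf : (m : ℝ) < f / a + 1 := Nat.ceil_lt_add_one (by positivity)
  let S : ℕ → Set Ω := fun k => {ω | (E.stats τ n ω).count G = k ∧
    (E.stats τ n ω).empMean G ≤ utility G I.mean - δ ∧
      (E.stats τ n ω).index (n + 1) G < utility G I.mean}
  have hS1 : ∀ k, P.real (S k) ≤ Real.exp (1 - f) := by
    intro k
    have hkl : ∀ ω ∈ S k, (f : EReal) < ((k : ℝ) : EReal) *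
        klBer ((E.stats τ n ω).empMean G / M) (utility G I.mean / M) := by
      rintro ω ⟨h1, h2, h3⟩
      by_contra hcon
      push Not at hcon
      rw [← h1] at hcon
      exact absurd ((E.stats τ n ω).le_index (by omega) hu.1 hu.2 hcon) (not_le.2 h3)
    rcases Nat.eq_zero_or_pos k with hk | hk
    -- With no observation every `q` in `[0, M]` qualifies, because `0 * ⊤ = 0`, so the index cannot
    -- fail.
    · have : S k = ∅ := by
        rw [Set.eq_empty_iff_forall_notMem]
        intro ω hω
        have := hkl ω hω
        rw [hk] at this
        simp at this
        linarith
      rw [this]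
      simpa using (Real.exp_pos _).le
    · refine le_trans (measureReal_mono ?_ (measure_ne_top _ _))
        (E.measureReal_klBer_le τ hM G hG hδ hf0 n k hk)
      exact fun ω hω => ⟨hω.1, hω.2.1, hkl ω hω⟩
  have hS2 : ∀ k, P.real (S k) ≤ Real.exp (-(a * k)) := by
    intro k
    refine le_trans (measureReal_mono ?_ (measure_ne_top _ _))
      (E.measureReal_deviation_le τ hM G hδ (s := -1) (by norm_num) n k)
    rintro ω ⟨h1, h2, h3⟩
    exact ⟨h1, by linarith⟩
  have hcover : {ω | (E.stats τ n ω).empMean G ≤ utility G I.mean - δ ∧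
      (E.stats τ n ω).index (n + 1) G < utility G I.mean} ⊆
      ⋃ k ∈ Finset.range (m + (n + 1)), S k := by
    rintro ω hω
    simp only [Set.mem_iUnion]
    exact ⟨_, Finset.mem_range.2 (by have := E.count_le τ n G ω; omega), rfl, hω⟩
  calc _ ≤ ∑ k ∈ Finset.range (m + (n + 1)), P.real (S k) :=
        (measureReal_mono hcover (measure_ne_top _ _)).trans (measureReal_biUnion_finset_le _ _)
    _ = ∑ k ∈ Finset.range m, P.real (S k) + ∑ k ∈ Finset.range (n + 1), P.real (S (m + k)) :=
        Finset.sum_range_add _ _ _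
    _ ≤ ∑ k ∈ Finset.range m, Real.exp (1 - f) +
        ∑ k ∈ Finset.range (n + 1), Real.exp (1 - f) * Real.exp (-(a * k)) := by
        refine add_le_add (Finset.sum_le_sum fun k _ => hS1 k) (Finset.sum_le_sum fun k _ => ?_)
        refine (hS2 _).trans ?_
        rw [← Real.exp_add]
        apply Real.exp_le_exp.2
        rw [div_le_iff₀ ha0] at hfm
        push_cast
        linarith
    _ ≤ Real.exp (1 - f) * (f / a + 1) + Real.exp (1 - f) * (1 + 1 / a) := by
        rw [← Finset.mul_sum, Finset.sum_const, Finset.card_range, nsmul_eq_mul, mul_comm (m : ℝ)]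
        exact add_le_add (mul_le_mul_of_nonneg_left hmf.le (Real.exp_pos _).le)
          (mul_le_mul_of_nonneg_left (sum_exp_neg_mul_le ha0 _) (Real.exp_pos _).le)
    _ = _ := by ring

lemma sum_measureReal_index_lt_le (hM : 1 ≤ M) (G : Matching M K) (hG : 0 < utility G I.mean)
    {δ : ℝ} (hδ : 0 < δ) (T : ℕ) :
    ∑ n ∈ Finset.range T, P.real {ω | (E.stats τ n ω).empMean G ≤ utility G I.mean - δ ∧
      (E.stats τ n ω).index (n + 1) G < utility G I.mean} ≤ 14 + 18 * (M ^ 2 / δ ^ 2) := by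
  have hM0 : (0 : ℝ) < M := by exact_mod_cast hM
  have ha0 : 0 < 2 * δ ^ 2 / (M : ℝ) ^ 2 := by positivity
  -- Here `3` bounds `e` and `6` comes from `1 + f ≤ 6 log t`. The weight `1 / (t log⁴ t)` loses one
  -- logarithm to `f`, leaving one to spare over `log²`.
  have hC : (0 : ℝ) ≤ 3 * (2 + 6 / (2 * δ ^ 2 / (M : ℝ) ^ 2)) := by positivity
  refine (sum_le_of_le_div_mul_log_sq hC (fun n => measureReal_le_one) (fun n hn => ?_)
    (fun n => measureReal_nonneg) T).trans_eq ?_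
  · refine (E.measureReal_index_lt_le τ hM G hG hδ n hn).trans ?_
    set a := 2 * δ ^ 2 / (M : ℝ) ^ 2
    have hL := one_le_log (t := n + 1) (by omega)
    rw [sub_eq_add_neg, Real.exp_add, exp_neg_explore (by omega)]
    have hf := explore_le (n + 1)
    have hf0 := explore_nonneg (t := n + 1) (by omega)
    push_cast at hL hf ⊢
    set L := Real.log ((n : ℝ) + 1)
    have h1 : 2 + (1 + explore (n + 1)) / a ≤ L * (2 + 6 / a) := by
      have : (1 + explore (n + 1)) / a ≤ (6 * L) / a := by gcongr; linarith
      have h6 : (6 * L) / a = L * (6 / a) := by ring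
      nlinarith
    have h2 : Real.exp 1 ≤ 3 := by linarith [Real.exp_one_lt_d9]
    have hn0 : (0 : ℝ) < n + 1 := by positivity
    calc Real.exp 1 * (1 / ((n + 1) * L ^ 4)) * (2 + (1 + explore (n + 1)) / a) ≤
          3 * (1 / ((n + 1) * L ^ 4)) * (L * (2 + 6 / a)) := by gcongr
      _ = 3 * (2 + 6 / a) / ((n + 1) * L ^ 3) := by field_simp
      _ ≤ _ := by gcongr; norm_num
  · field_simp
    ring

end Environment

end HintedBandit

/-! ### Counting bad pulls and hint rounds -/

namespace HintedBandit

lemma sum_Icc_one_eq_sum_range (f : ℕ → ℝ) (T : ℕ) :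
    ∑ t ∈ Finset.Icc 1 T, f t = ∑ n ∈ Finset.range T, f (n + 1) := by
  induction T with
  | zero => simp
  | succ T ih => rw [Finset.sum_Icc_succ_top (by omega), ih, Finset.sum_range_succ]

lemma card_matching (M K : ℕ) : ((Finset.univ : Finset (Matching M K)).card : ℝ) = (K : ℝ) ^ M := by
  simp

lemma sq_le_pow {M K : ℕ} (hK : M < K) : (M : ℝ) ^ 2 ≤ (K : ℝ) ^ M := by
  have h : M ^ 2 ≤ K ^ M := by
    rcases Nat.lt_or_ge M 2 with h | h
    · interval_cases M
      · simp
      · simpa using hK.le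
    · exact (Nat.pow_le_pow_left hK.le 2).trans (Nat.pow_le_pow_right (by omega) h)
  exact_mod_cast h

namespace Environment

variable {M K : ℕ} {I : Instance M K} {Ω : Type*} [MeasurableSpace Ω] {P : Measure Ω}
  (E : Environment I P) (τ : TieBreak M K) [IsProbabilityMeasure P]

open Classical in
omit [IsProbabilityMeasure P] in
lemma integral_ite_stats (n : ℕ) (p : Stats M K → Prop) :
    ∫ ω, (if p (E.stats τ n ω) then (1 : ℝ) else 0) ∂P = P.real {ω | p (E.stats τ n ω)} := by
  have hm : MeasurableSet {ω | p (E.stats τ n ω)} :=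
    measurableSet_setOfPred.2 (E.measurable_comp_stats τ n fun s _ => p s)
  rw [← integral_indicator_one hm]
  rfl

/-- The expected number of rounds in which a suboptimal matching is pulled is bounded. -/
lemma sum_measureReal_pulled_ne_best_le (hM : 1 ≤ M) (hK : M < K) {δ : ℝ} (hδ : 0 < δ)
    (hgap : δ < I.minGap / 2) (T : ℕ) :
    ∑ n ∈ Finset.range T, P.real {ω | τ.pulled (n + 1) (E.stats τ n ω) ≠ I.best} ≤
      K ^ M * (17 + 20 * (M ^ 2 / δ ^ 2)) := by
  have hbest := I.minGap_le_utility_best hM hK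
  have hK1 : (1 : ℝ) ≤ (K : ℝ) ^ M := one_le_pow₀ (by exact_mod_cast (by omega : 1 ≤ K))
  have hub := utility_mem_Icc I.best I.mean_mem
  let A : ℕ → Matching M K → Set Ω := fun n G => {ω | E.Obs τ n G ω ∧
    δ ≤ 1 * ((E.stats τ n ω).empMean G - utility G I.mean)}
  let B : ℕ → Set Ω := fun n => {ω | τ.Asks (n + 1) (E.stats τ n ω) ∧
    δ ≤ -1 * ((E.stats τ n ω).empMean I.best - utility I.best I.mean)}
  let D : ℕ → Set Ω := fun n => {ω |
    (E.stats τ n ω).empMean I.best ≤ utility I.best I.mean - δ ∧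
      (E.stats τ n ω).index (n + 1) I.best < utility I.best I.mean}
  have hcover : ∀ n, {ω | τ.pulled (n + 1) (E.stats τ n ω) ≠ I.best} ⊆
      ((⋃ G ∈ (Finset.univ : Finset (Matching M K)), A n G) ∪ B n) ∪ D n := by
    intro n ω hω
    have hω : τ.pulled (n + 1) (E.stats τ n ω) ≠ I.best := hω
    by_cases h1 : δ ≤ 1 * ((E.stats τ n ω).empMean (τ.pulled (n + 1) (E.stats τ n ω)) -
        utility (τ.pulled (n + 1) (E.stats τ n ω)) I.mean)
    · left; left
      simp only [Set.mem_iUnion]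
      exact ⟨_, Finset.mem_univ _, Or.inl rfl, h1⟩
    -- As `2 δ < minGap`, the chain from the best matching's mean through the pulled one's mean
    -- gives an underestimate: it stays below `U* - minGap + δ < U* - δ`.
    have h2 := I.minGap_le hω
    have h3 := τ.empMean_le_pulled (n + 1) (E.stats τ n ω) I.best
    by_cases h4 : (E.stats τ n ω).index (n + 1) I.best < utility I.best I.mean
    · right
      exact ⟨by linarith, h4⟩
    · left; right
      -- The best matching is not pulled, so it competes for candidate; the candidate's index is at
      -- least `U*`, above the pulled mean, and a hint is queried.
      have h5 := τ.index_le_candidate (n + 1) (E.stats τ n ω) (Ne.symm hω)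
      exact ⟨show _ < _ by linarith, by linarith⟩
  have hA : ∀ G, ∑ n ∈ Finset.range T, P.real (A n G) ≤ 1 + M ^ 2 / (2 * δ ^ 2) := fun G =>
    E.sum_measureReal_obs_deviation_le τ hM G hδ (by norm_num) T
  have hB : ∑ n ∈ Finset.range T, P.real (B n) ≤ 2 * K ^ M * (1 + M ^ 2 / (2 * δ ^ 2)) := by
    refine le_trans ?_ (mul_le_mul_of_nonneg_left
      (E.sum_measureReal_obs_deviation_le τ hM I.best hδ (s := -1) (by norm_num) T)
      (by positivity))
    rw [Finset.mul_sum]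
    exact Finset.sum_le_sum fun n _ => E.measureReal_asks_le_unif τ (by omega) n I.best
      fun s => δ ≤ -1 * (s.empMean I.best - utility I.best I.mean)
  have hD : ∑ n ∈ Finset.range T, P.real (D n) ≤ 14 + 18 * (M ^ 2 / δ ^ 2) :=
    E.sum_measureReal_index_lt_le τ hM I.best (by linarith) hδ T
  have hsum : ∑ n ∈ Finset.range T, P.real {ω | τ.pulled (n + 1) (E.stats τ n ω) ≠ I.best} ≤
      ∑ G : Matching M K, ∑ n ∈ Finset.range T, P.real (A n G) +
        ∑ n ∈ Finset.range T, P.real (B n) + ∑ n ∈ Finset.range T, P.real (D n) := by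
    rw [Finset.sum_comm, ← Finset.sum_add_distrib, ← Finset.sum_add_distrib]
    refine Finset.sum_le_sum fun n _ => ?_
    have h1 := measureReal_mono (μ := P) (hcover n) (measure_ne_top _ _)
    have h2 := measureReal_union_le (μ := P)
      ((⋃ G ∈ (Finset.univ : Finset (Matching M K)), A n G) ∪ B n) (D n)
    have h3 := measureReal_union_le (μ := P)
      (⋃ G ∈ (Finset.univ : Finset (Matching M K)), A n G) (B n)
    have h4 := measureReal_biUnion_finset_le (μ := P) Finset.univ (A n)
    linarith
  have hA' : ∑ G : Matching M K, ∑ n ∈ Finset.range T, P.real (A n G) ≤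
      K ^ M * (1 + M ^ 2 / (2 * δ ^ 2)) := by
    refine (Finset.sum_le_sum fun G _ => hA G).trans_eq ?_
    rw [Finset.sum_const, nsmul_eq_mul, card_matching]
  have hd : (M : ℝ) ^ 2 / (2 * δ ^ 2) = (M ^ 2 / δ ^ 2) / 2 := by ring
  rw [hd] at hA' hB
  set d : ℝ := (M : ℝ) ^ 2 / δ ^ 2
  have hd0 : 0 ≤ d := by positivity
  nlinarith [mul_nonneg (sub_nonneg.2 hK1) hd0]

lemma regret_le (T : ℕ) : E.regret τ T ≤
    M * ∑ n ∈ Finset.range T, P.real {ω | τ.pulled (n + 1) (E.stats τ n ω) ≠ I.best} := by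
  classical
  unfold regret
  rw [sum_Icc_one_eq_sum_range, Finset.mul_sum]
  refine Finset.sum_le_sum fun n _ => ?_
  rw [Nat.add_sub_cancel]
  have hi : Integrable (fun ω => utility (τ.pulled (n + 1) (E.stats τ n ω)) I.mean) P :=
    E.integrable_comp_stats τ n fun s _ => utility (τ.pulled (n + 1) s) I.mean
  have hi' : Integrable (fun ω => utility I.best I.mean -
      utility (τ.pulled (n + 1) (E.stats τ n ω)) I.mean) P := (integrable_const _).sub hi
  have hj : Integrable (fun ω => (M : ℝ) *
      if τ.pulled (n + 1) (E.stats τ n ω) ≠ I.best then (1 : ℝ) else 0) P :=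
    E.integrable_comp_stats τ n fun s _ =>
      (M : ℝ) * if τ.pulled (n + 1) s ≠ I.best then (1 : ℝ) else 0
  have h1 : utility I.best I.mean - ∫ ω, utility (τ.pulled (n + 1) (E.stats τ n ω)) I.mean ∂P =
      ∫ ω, (utility I.best I.mean - utility (τ.pulled (n + 1) (E.stats τ n ω)) I.mean) ∂P := by
    rw [integral_sub (integrable_const _) hi, integral_const, probReal_univ, one_smul]
  have h2 : (M : ℝ) * P.real {ω | τ.pulled (n + 1) (E.stats τ n ω) ≠ I.best} =
      ∫ ω, (M : ℝ) * (if τ.pulled (n + 1) (E.stats τ n ω) ≠ I.best then (1 : ℝ) else 0) ∂P := by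
    rw [integral_const_mul]
    congr 1
    exact ((E.integral_ite_stats τ n fun s => τ.pulled (n + 1) s ≠ I.best).symm.trans
      (by congr!))
  rw [h1, h2]
  refine integral_mono hi' hj fun ω => ?_
  by_cases h : τ.pulled (n + 1) (E.stats τ n ω) = I.best
  · simp [h]
  · simp only [ne_eq, h, not_false_eq_true, if_true, mul_one]
    linarith [(utility_mem_Icc I.best I.mean_mem).2,
      (utility_mem_Icc (τ.pulled (n + 1) (E.stats τ n ω)) I.mean_mem).1]

lemma hints_eq (T : ℕ) : E.hints τ T =
    M * ∑ n ∈ Finset.range T, P.real {ω | τ.Asks (n + 1) (E.stats τ n ω)} := by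
  classical
  unfold hints
  simp only [sum_Icc_one_eq_sum_range, Nat.add_sub_cancel, Finset.sum_const, Finset.card_univ,
    Fintype.card_fin, nsmul_eq_mul]
  rw [integral_const_mul, integral_finsetSum _ fun n _ => E.integrable_comp_stats τ n fun s _ =>
    if τ.Asks (n + 1) s then (1 : ℝ) else 0]
  congr 1
  exact Finset.sum_congr rfl fun n _ => E.integral_ite_stats τ n fun s => τ.Asks (n + 1) s

omit [IsProbabilityMeasure P] in
/-- If the empirical means of the best matching and of a suboptimal candidate are accurate and a
hint is queried, the candidate has been observed only logarithmically often. -/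
lemma count_mul_klGap_le (hM : 1 ≤ M) (hK : M < K) {δ : ℝ} (hδ : 0 < δ)
    (hgap : δ < I.minGap / 2) (n : ℕ) (ω : Ω) (hask : τ.Asks (n + 1) (E.stats τ n ω))
    (hpull : τ.pulled (n + 1) (E.stats τ n ω) = I.best)
    (h1 : utility I.best I.mean - δ ≤ (E.stats τ n ω).empMean I.best)
    (h2 : (E.stats τ n ω).empMean (τ.candidate (n + 1) (E.stats τ n ω)) ≤
      utility (τ.candidate (n + 1) (E.stats τ n ω)) I.mean + δ) :
    (E.stats τ n ω).count (τ.candidate (n + 1) (E.stats τ n ω)) * I.klGap δ ≤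
      5 * Real.log (n + 1) := by
  have hM0 : (0 : ℝ) < M := by exact_mod_cast hM
  have hbest := I.minGap_le_utility_best hM hK
  have hub := utility_mem_Icc I.best I.mean_mem
  have hne := τ.candidate_ne_pulled hM hK (n + 1) (E.stats τ n ω)
  rw [hpull] at hne
  have hg := I.minGap_le hne
  unfold TieBreak.Asks at hask
  rw [hpull] at hask
  set G := τ.candidate (n + 1) (E.stats τ n ω)
  -- The candidate's index exceeds the best matching's empirical mean, so some admissible `q` lies
  -- above `U* - δ`. Its divergence from the candidate's mean, itself at most `U* - minGap + δ`,
  -- dominates `klGap`.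
  obtain ⟨q, hq1, hq2, hq3⟩ := (E.stats τ n ω).exists_of_lt_index
    (c := utility I.best I.mean - δ) (by linarith) (by linarith : _ < _)
  have hx := E.empMean_mem_Icc τ n G ω
  set a := (utility I.best I.mean - I.minGap + δ) / M with ha
  set b := (utility I.best I.mean - δ) / M with hb
  have hb0 : 0 < b := div_pos (by linarith) hM0
  have hb1 : b < 1 := (div_lt_one hM0).2 (by linarith [hub.2])
  have hmono : klBer a b ≤ klBer ((E.stats τ n ω).empMean G / M) (q / M) :=
    klBer_mono (div_nonneg hx.1 hM0.le) (div_le_div_of_nonneg_right (by linarith) hM0.le)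
      (div_pos (by linarith) hM0) (div_le_div_of_nonneg_right (by linarith) hM0.le) hb1
      (div_le_div_of_nonneg_right hq1.le hM0.le) ((div_le_one hM0).2 hq2)
  have hle : (((E.stats τ n ω).count G : ℝ) : EReal) * klBer a b ≤
      ((explore (n + 1) : ℝ) : EReal) :=
    (mul_le_mul_of_nonneg_left hmono (by exact_mod_cast Nat.cast_nonneg _)).trans hq3
  rw [klBer_eq_coe hb0.ne' hb1.ne, ← EReal.coe_mul, EReal.coe_le_coe_iff] at hle
  have hexp := explore_le (n + 1)
  push_cast at hexp
  exact hle.trans hexp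

lemma klGap_pos (hM : 1 ≤ M) (hK : M < K) {δ : ℝ} (hδ : 0 < δ) (hgap : δ < I.minGap / 2) :
    0 < I.klGap δ := by
  have hM0 : (0 : ℝ) < M := by exact_mod_cast hM
  have hbest := I.minGap_le_utility_best hM hK
  have hub := utility_mem_Icc I.best I.mean_mem
  exact klBer_toReal_pos (div_pos (by linarith) hM0)
    (div_lt_div_of_pos_right (by linarith) hM0) ((div_lt_one hM0).2 (by linarith [hub.2]))

lemma sum_measureReal_asks_le (hM : 1 ≤ M) (hK : M < K) {δ : ℝ} (hδ : 0 < δ)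
    (hgap : δ < I.minGap / 2) (T : ℕ) :
    ∑ n ∈ Finset.range T, P.real {ω | τ.Asks (n + 1) (E.stats τ n ω)} ≤
      K ^ M * (22 + 22 * (M ^ 2 / δ ^ 2) + 10 * Real.log T / I.klGap δ) := by
  have hκ := klGap_pos hM hK hδ hgap
  have hK1 : (1 : ℝ) ≤ (K : ℝ) ^ M := one_le_pow₀ (by exact_mod_cast (by omega : 1 ≤ K))
  set κ := I.klGap δ with hκdef
  set R := ⌊5 * Real.log T / κ⌋₊ + 1 with hR
  have hlogT := Real.log_natCast_nonneg T
  have hRle : (R : ℝ) ≤ 5 * Real.log T / κ + 1 := by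
    rw [hR]
    push_cast
    linarith [Nat.floor_le (show 0 ≤ 5 * Real.log T / κ by positivity)]
  let A : ℕ → Set Ω := fun n => {ω | τ.pulled (n + 1) (E.stats τ n ω) ≠ I.best}
  let B : ℕ → Set Ω := fun n => {ω | E.Obs τ n I.best ω ∧
    δ ≤ -1 * ((E.stats τ n ω).empMean I.best - utility I.best I.mean)}
  let C : ℕ → Matching M K → Set Ω := fun n G => {ω | τ.Asks (n + 1) (E.stats τ n ω) ∧
    τ.candidate (n + 1) (E.stats τ n ω) = G ∧
    δ ≤ 1 * ((E.stats τ n ω).empMean G - utility G I.mean)}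
  let D : ℕ → Matching M K → Set Ω := fun n G => {ω | τ.Asks (n + 1) (E.stats τ n ω) ∧
    τ.candidate (n + 1) (E.stats τ n ω) = G ∧ (E.stats τ n ω).count G < R}
  have hcover : ∀ n < T, {ω | τ.Asks (n + 1) (E.stats τ n ω)} ⊆
      (A n ∪ B n) ∪ ((⋃ G ∈ (Finset.univ : Finset (Matching M K)), C n G) ∪
        ⋃ G ∈ (Finset.univ : Finset (Matching M K)), D n G) := by
    intro n hn ω hω
    have hω : τ.Asks (n + 1) (E.stats τ n ω) := hω
    by_cases h1 : τ.pulled (n + 1) (E.stats τ n ω) = I.best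
    · by_cases h2 : δ ≤ -1 * ((E.stats τ n ω).empMean I.best - utility I.best I.mean)
      · exact Or.inl (Or.inr ⟨Or.inl h1.symm, h2⟩)
      · right
        by_cases h3 : δ ≤ 1 * ((E.stats τ n ω).empMean (τ.candidate (n + 1) (E.stats τ n ω)) -
            utility (τ.candidate (n + 1) (E.stats τ n ω)) I.mean)
        · left
          simp only [Set.mem_iUnion]
          exact ⟨_, Finset.mem_univ _, hω, rfl, h3⟩
        · right
          simp only [Set.mem_iUnion]
          refine ⟨_, Finset.mem_univ _, hω, rfl, ?_⟩
          have h4 := E.count_mul_klGap_le τ hM hK hδ hgap n ω hω h1 (by linarith) (by linarith)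
          have h5 : Real.log ((n : ℝ) + 1) ≤ Real.log T :=
            Real.log_le_log (by positivity) (by exact_mod_cast hn)
          rw [hR, Nat.lt_succ_iff, Nat.le_floor_iff (by positivity), le_div_iff₀ hκ]
          linarith
    · exact Or.inl (Or.inl h1)
  have hA := E.sum_measureReal_pulled_ne_best_le τ hM hK hδ hgap T
  have hB : ∑ n ∈ Finset.range T, P.real (B n) ≤ 1 + M ^ 2 / (2 * δ ^ 2) :=
    E.sum_measureReal_obs_deviation_le τ hM I.best hδ (by norm_num) T
  have hC : ∑ G : Matching M K, ∑ n ∈ Finset.range T, P.real (C n G) ≤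
      K ^ M * (2 * (1 + M ^ 2 / (2 * δ ^ 2))) := by
    refine (Finset.sum_le_sum (g := fun _ => 2 * (1 + (M : ℝ) ^ 2 / (2 * δ ^ 2)))
      fun G _ => ?_).trans_eq (by rw [Finset.sum_const, nsmul_eq_mul, card_matching])
    refine le_trans ?_ (mul_le_mul_of_nonneg_left
      (E.sum_measureReal_obs_deviation_le τ hM G hδ (s := 1) (by norm_num) T) zero_le_two)
    rw [Finset.mul_sum]
    exact Finset.sum_le_sum fun n _ => E.measureReal_asks_le_candidate τ n G
      fun s => δ ≤ 1 * (s.empMean G - utility G I.mean)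
  have hD : ∑ G : Matching M K, ∑ n ∈ Finset.range T, P.real (D n G) ≤ K ^ M * (2 * R) := by
    refine (Finset.sum_le_sum (g := fun _ => 2 * (R : ℝ))
      fun G _ => ?_).trans_eq (by rw [Finset.sum_const, nsmul_eq_mul, card_matching])
    refine le_trans ?_ (mul_le_mul_of_nonneg_left
      (E.sum_measureReal_obs_count_lt_le τ G T R) zero_le_two)
    rw [Finset.mul_sum]
    exact Finset.sum_le_sum fun n _ => E.measureReal_asks_le_candidate τ n G
      fun s => s.count G < R
  have hsum : ∑ n ∈ Finset.range T, P.real {ω | τ.Asks (n + 1) (E.stats τ n ω)} ≤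
      ∑ n ∈ Finset.range T, P.real (A n) + ∑ n ∈ Finset.range T, P.real (B n) +
        (∑ G : Matching M K, ∑ n ∈ Finset.range T, P.real (C n G) +
          ∑ G : Matching M K, ∑ n ∈ Finset.range T, P.real (D n G)) := by
    rw [Finset.sum_comm (s := Finset.univ), Finset.sum_comm (s := Finset.univ),
      ← Finset.sum_add_distrib, ← Finset.sum_add_distrib, ← Finset.sum_add_distrib]
    refine Finset.sum_le_sum fun n hn => ?_
    have h1 := measureReal_mono (μ := P) (hcover n (Finset.mem_range.1 hn)) (measure_ne_top _ _)
    have h2 := measureReal_union_le (μ := P) (A n ∪ B n)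
      ((⋃ G ∈ (Finset.univ : Finset (Matching M K)), C n G) ∪
        ⋃ G ∈ (Finset.univ : Finset (Matching M K)), D n G)
    have h3 := measureReal_union_le (μ := P)
      (⋃ G ∈ (Finset.univ : Finset (Matching M K)), C n G)
      (⋃ G ∈ (Finset.univ : Finset (Matching M K)), D n G)
    have h4 := measureReal_biUnion_finset_le (μ := P) Finset.univ (C n)
    have h5 := measureReal_biUnion_finset_le (μ := P) Finset.univ (D n)
    have h6 := measureReal_union_le (μ := P) (A n) (B n)
    linarith
  have hd : (M : ℝ) ^ 2 / (2 * δ ^ 2) = (M ^ 2 / δ ^ 2) / 2 := by ring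
  rw [hd] at hB hC
  set d : ℝ := (M : ℝ) ^ 2 / δ ^ 2
  have hd0 : 0 ≤ d := by positivity
  have hD' : (K : ℝ) ^ M * (2 * R) ≤ K ^ M * (2 * (5 * Real.log T / κ + 1)) := by gcongr
  have h10 : 10 * Real.log T / κ = 2 * (5 * Real.log T / κ) := by ring
  rw [h10]
  nlinarith [mul_nonneg (sub_nonneg.2 hK1) hd0]

end Environment

end HintedBandit

theorem mainTheorem2 :
    (∀ δ : ℝ, 0 < δ → ∃ C : ℝ, 0 < C ∧
      ∀ (M K : ℕ) (_ : 1 ≤ M) (_ : M < K) (I : HintedBandit.Instance M K)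
        (_ : δ < I.minGap / 2)
        (Ω : Type*) [MeasurableSpace Ω] (P : MeasureTheory.Measure Ω)
        [MeasureTheory.IsProbabilityMeasure P]
        (E : HintedBandit.Environment I P) (τ : HintedBandit.TieBreak M K) (T : ℕ),
        E.regret τ T ≤ C * ((M : ℝ) * (K : ℝ) ^ (2 * M))) ∧
    (∃ C : ℝ, 0 < C ∧
      ∀ (M K : ℕ) (_ : 1 ≤ M) (_ : M < K) (I : HintedBandit.Instance M K)
        (δ : ℝ) (_ : 0 < δ) (_ : δ < I.minGap / 2)
        (Ω : Type*) [MeasurableSpace Ω] (P : MeasureTheory.Measure Ω)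
        [MeasureTheory.IsProbabilityMeasure P]
        (E : HintedBandit.Environment I P) (τ : HintedBandit.TieBreak M K),
        ∀ᶠ T : ℕ in Filter.atTop,
          E.hints τ T ≤ C * ((M : ℝ) * (K : ℝ) ^ M * Real.log T / I.klGap δ)) := by
  -- In the hint bound, `10` is the coefficient of the logarithm and the extra `1` absorbs the terms
  -- independent of `T` once `T` is large.
  refine ⟨fun δ hδ => ⟨17 + 20 / δ ^ 2, by positivity, ?_⟩, 11, by norm_num, ?_⟩
  · intro M K hM hK I hgap Ω _ P _ E τ T
    have hK1 : (1 : ℝ) ≤ (K : ℝ) ^ M := one_le_pow₀ (by exact_mod_cast (by omega : 1 ≤ K))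
    have hsq := HintedBandit.sq_le_pow hK
    calc E.regret τ T ≤ M * (K ^ M * (17 + 20 * (M ^ 2 / δ ^ 2))) :=
          (E.regret_le τ T).trans (mul_le_mul_of_nonneg_left
            (E.sum_measureReal_pulled_ne_best_le τ hM hK hδ hgap T) (Nat.cast_nonneg _))
      _ ≤ M * (K ^ M * (17 * K ^ M + 20 * (K ^ M / δ ^ 2))) := by
          gcongr
          linarith
      _ = _ := by
          rw [two_mul, pow_add]
          ring
  · intro M K hM hK I δ hδ hgap Ω _ P _ E τ
    have hκ := HintedBandit.Environment.klGap_pos hM hK hδ hgap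
    have hlog : Filter.Tendsto (fun T : ℕ => Real.log T) Filter.atTop Filter.atTop :=
      Real.tendsto_log_atTop.comp tendsto_natCast_atTop_atTop
    filter_upwards [hlog.eventually_ge_atTop ((22 + 22 * (M ^ 2 / δ ^ 2)) * I.klGap δ)] with T hT
    rw [← le_div_iff₀ hκ] at hT
    rw [E.hints_eq]
    calc _ ≤ (M : ℝ) * (K ^ M *
            (22 + 22 * (M ^ 2 / δ ^ 2) + 10 * Real.log T / I.klGap δ)) :=
          mul_le_mul_of_nonneg_left (E.sum_measureReal_asks_le τ hM hK hδ hgap T)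
            (Nat.cast_nonneg _)
      _ ≤ (M : ℝ) * (K ^ M * (Real.log T / I.klGap δ + 10 * Real.log T / I.klGap δ)) := by
          gcongr
      _ = _ := by ring
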